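/- Let $K\subset\mathbb C$ be a finite abelian extension of $\mathbb Q$ with ring of integers $\mathbb Z_K$, let $\mu(K)$ be the group of roots of unity of $K$, and put $\zeta_d=\exp(2\pi i/d)$. Let $V$ be a finite-dimensional $K$-vector space and $W\subset \mathrm{GL}(V)$ a finite subgroup generated by pseudo-reflections and acting irreducibly on $V$. Let $\mathcal A$ be the set of reflecting hyperplanes of $W$, $V^{\mathrm{reg}}$ the complement of these hyperplanes in $\mathbb C\otimes_K V$, $x_0\in V^{\mathrm{reg}}$, and $B=\pi_1(V^{\mathrm{reg}}/W,x_0)$. For $\mathcal C\in\mathcal A/W$ let $e_{\mathcal C}$ be the common order of the pointwise stabilizers $W_H$, $H\in\mathcal C$, and let $\mathbf S_{\mathcal C}\subset B$ be the set of monodromy generators around the images of the hyperplanes of $\mathcal C$. Let $\mathcal H(W)$ be the generic Hecke algebra: the quotient of the group algebra $\mathbb Z[\mathbf u,\mathbf u^{-1}]B$, where $\mathbf u=(u_{\mathcal C,j})_{\mathcal C\in\mathcal A/W,\,0\le j<e_{\mathcal C}}$ are indeterminates, by the relations $\prod_{j=0}^{e_{\mathcal C}-1}(\mathbf s-u_{\mathcal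 C,j})=0$ for $\mathcal C\in\mathcal A/W$, $\mathbf s\in\mathbf S_{\mathcal C}$. Assume that $\mathcal H(W)$ is a free $\mathbb Z[\mathbf u,\mathbf u^{-1}]$-module of rank $|W|$, and that there is a unique linear form $t:\mathcal H(W)\to\mathbb Z[\mathbf u,\mathbf u^{-1}]$ such that: (1) $t$ is a symmetrizing form; (2) under $u_{\mathcal C,j}\mapsto\zeta_{e_{\mathcal C}}^{\,j}$ it becomes the canonical form $w\mapsto\delta_{w,1}$ of the group algebra of $W$; (3) $t(b^{-1})^*=t(b\boldsymbol\pi)/t(\boldsymbol\pi)$ for all $b\in B$, where $*$ is the simultaneous inversion of the indeterminates and $\boldsymbol\pi\in B$ is the class of the loop $s\mapsto \exp(2\pi i s)x_0$. Let $q=y^{|\mu(K)|}$ with $y$ an indeterminate. For a family of integers $\mathbf m=(m_{\mathcal C,j})$ let $\varphi_{\mathbf m}:u_{\mathcal C,j}\mapsto \zeta_{e_{\mathcal C}}^{\,j}q^{m_{\mathcal C,j}}$, let $\mathcal H_{\mathbf m}$ be the corresponding cyclotomic Hecke algebra over $\mathbb Z_K[q,q^{-1}]$, and let $t_{\varphi_{\mathbf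 m}}$ be the specialization of $t$. Let $\Lambda$ index the irreducible characters of $W$ over $K$; for $\boldsymbol\lambda\in\Lambda$ let $V^{\boldsymbol\lambda}_{\varphi_{\mathbf m}}$ be the irreducible representation of the split semisimple algebra $K(y)\mathcal H_{\mathbf m}$ whose character specializes to $\boldsymbol\lambda$ under $y\mapsto 1$. Let $s^{\varphi_{\mathbf m}}_{\boldsymbol\lambda}$ be its Schur element with respect to $t_{\varphi_{\mathbf m}}$, so that $t_{\varphi_{\mathbf m}}=\sum_{\chi\in\mathrm{Irr}(K(y)\mathcal H_{\mathbf m})}\frac1{s_\chi}\chi$ and $s^{\varphi_{\mathbf m}}_{\boldsymbol\lambda}=s_\chi$ for the character $\chi$ of $V^{\boldsymbol\lambda}_{\varphi_{\mathbf m}}$. Let $a^{\varphi_{\mathbf m}}_{\boldsymbol\lambda}=-\mathrm{val}_y(s^{\varphi_{\mathbf m}}_{\boldsymbol\lambda})/|\mu(K)|$, where $\mathrm{val}_y$ is the order at $y=0$. Let $\mathbf m$ and $\mathbf n$ be families of integers such that $n_{\mathcal C,0}=n_{\mathcal C,1}=\cdots=n_{\mathcal C,e_{\mathcal C}-1}$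 for every $\mathcal C\in\mathcal A/W$. Then, for every $\boldsymbol\lambda\in\Lambda$, $$s^{\varphi_{\mathbf m}}_{\boldsymbol\lambda}=s^{\varphi_{\mathbf m+\mathbf n}}_{\boldsymbol\lambda}\qquad\text{and}\qquad a^{\varphi_{\mathbf m}}_{\boldsymbol\lambda}=a^{\varphi_{\mathbf m+\mathbf n}}_{\boldsymbol\lambda}.$$ -/

import Mathlib

open scoped TensorProduct LaurentPolynomial

noncomputable section

namespace ReflectionHecke

/-! ### Complex reflection groups -/

section Groups

variable {K : Type*} [Field K] {V : Type*} [AddCommGroup V] [Module K V]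

/-- A pseudo-reflection: a non-trivial element acting trivially on a hyperplane. -/
def IsPseudoReflection (s : V ≃ₗ[K] V) : Prop :=
  s ≠ 1 ∧ ∃ H : Submodule K V, IsCoatom H ∧ ∀ v ∈ H, s v = v

/-- `W` is generated by the pseudo-reflections that it contains. -/
def IsGeneratedByReflections (W : Subgroup (V ≃ₗ[K] V)) : Prop :=
  Subgroup.closure {s | s ∈ W ∧ IsPseudoReflection s} = W

/-- `W` acts irreducibly on `V`. -/
def ActsIrreducibly (W : Subgroup (V ≃ₗ[K] V)) : Prop :=
  Nontrivial V ∧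
    ∀ U : Submodule K V, (∀ w ∈ W, ∀ v ∈ U, w v ∈ U) → U = ⊥ ∨ U = ⊤

/-- The set `𝒜` of reflecting hyperplanes of `W`. -/
def hyperplanes (W : Subgroup (V ≃ₗ[K] V)) : Set (Submodule K V) :=
  {H | IsCoatom H ∧ ∃ s ∈ W, s ≠ 1 ∧ ∀ v ∈ H, s v = v}

/-- The pointwise stabilizer `W_H` of `H`. -/
def fixer (W : Subgroup (V ≃ₗ[K] V)) (H : Submodule K V) : Subgroup W :=
  fixingSubgroup W (H : Set V)

theorem mem_fixer {W : Subgroup (V ≃ₗ[K] V)} {H : Submodule K V} {w : W} :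
    w ∈ fixer W H ↔ ∀ v ∈ H, w.1 v = v :=
  mem_fixingSubgroup_iff W

theorem card_fixer_map {W : Subgroup (V ≃ₗ[K] V)} (H : Submodule K V) (w : W) :
    Nat.card (fixer W (H.map (w.1 : V →ₗ[K] V))) = Nat.card (fixer W H) := by
  symm
  refine Nat.card_congr (((MulAut.conj w).subgroupMap (fixer W H)).trans
    (MulEquiv.subgroupCongr ?_)).toEquiv
  ext g
  constructor
  · rintro ⟨h, hh, rfl⟩
    rw [mem_fixer]
    rintro _ ⟨v, hv, rfl⟩
    have h2 : w.1⁻¹ (w.1 v) = v := w.1.symm_apply_apply v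
    change w.1 (h.1 (w.1⁻¹ (w.1 v))) = w.1 v
    rw [h2, mem_fixer.1 hh v hv]
  · intro hg
    refine ⟨w⁻¹ * g * w, ?_, by simp [mul_assoc]⟩
    refine mem_fixer.2 fun v hv => ?_
    change w.1⁻¹ (g.1 (w.1 v)) = v
    rw [mem_fixer.1 hg (w.1 v) ⟨v, hv, rfl⟩]
    exact w.1.symm_apply_apply v

/-- Two reflecting hyperplanes are equivalent when they lie in the same orbit of `W` on `𝒜`. -/
def hyperplaneSetoid (W : Subgroup (V ≃ₗ[K] V)) : Setoid (hyperplanes W) where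
  r H H' := ∃ w : W, H.1.map (w.1 : V →ₗ[K] V) = H'.1
  iseqv :=
    { refl := fun H => ⟨1, Submodule.map_id H.1⟩
      symm := by
        rintro H H' ⟨w, hw⟩
        refine ⟨w⁻¹, ?_⟩
        rw [← hw, ← Submodule.map_comp]
        convert Submodule.map_id H.1
        ext v
        exact w.1.symm_apply_apply v
      trans := by
        rintro H H' H'' ⟨w, hw⟩ ⟨w', hw'⟩
        refine ⟨w' * w, ?_⟩
        rw [← hw', ← hw, ← Submodule.map_comp]
        rfl }

/-- The set `𝒜/W` of orbits of reflecting hyperplanes. -/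
def Orbits (W : Subgroup (V ≃ₗ[K] V)) : Type _ := Quotient (hyperplaneSetoid W)

/-- The orbit of a reflecting hyperplane. -/
def orbitOf {W : Subgroup (V ≃ₗ[K] V)} (H : hyperplanes W) : Orbits W :=
  Quotient.mk (hyperplaneSetoid W) H

/-- `e_𝒞`, the common order of the groups `W_H` for `H ∈ 𝒞`. -/
def ramification {W : Subgroup (V ≃ₗ[K] V)} (C : Orbits W) : ℕ :=
  Quotient.lift (s := hyperplaneSetoid W) (fun H => Nat.card (fixer W H.1))
    (by
      rintro H H' ⟨w, hw⟩
      rw [← hw]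
      exact (card_fixer_map H.1 w).symm) C

/-- The index set of the indeterminates `u_{𝒞,j}`, `𝒞 ∈ 𝒜/W`, `0 ≤ j ≤ e_𝒞 - 1`. -/
abbrev ParamIndex (W : Subgroup (V ≃ₗ[K] V)) : Type _ :=
  Σ C : Orbits W, Fin (ramification C)

/-- `ℳ = ∏_𝒞 ℤ^{e_𝒞}`. -/
abbrev Weights (W : Subgroup (V ≃ₗ[K] V)) : Type _ :=
  (C : Orbits W) → Fin (ramification C) → ℤ

theorem map_mem_hyperplanes {W : Subgroup (V ≃ₗ[K] V)} {w : V ≃ₗ[K] V} (hw : w ∈ W)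
    {H : Submodule K V} (hH : H ∈ hyperplanes W) : H.map (w : V →ₗ[K] V) ∈ hyperplanes W := by
  obtain ⟨h1, s, hs, hs1, hsH⟩ := hH
  refine ⟨?_, w * s * w⁻¹, W.mul_mem (W.mul_mem hw hs) (W.inv_mem hw), ?_, ?_⟩
  · exact (OrderIso.isCoatom_iff (Submodule.orderIsoMapComap w) H).2 h1
  · intro h
    apply hs1
    have : w * s = w := by simpa using mul_inv_eq_one.1 h
    simpa using this
  · rintro _ ⟨v, hv, rfl⟩
    have h2 : w⁻¹ (w v) = v := w.symm_apply_apply v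
    change w (s (w⁻¹ (w v))) = w v
    rw [h2, hsH v hv]

theorem fixer_le_comap {W : Subgroup (V ≃ₗ[K] V)} {H : Submodule K V} (w : fixer W H) :
    H ≤ H.comap (w.1.1 : V →ₗ[K] V) := fun v hv => by
  have h := mem_fixer.1 w.2 v hv
  change w.1.1 v ∈ H
  rwa [h]

theorem fixer_pow {W : Subgroup (V ≃ₗ[K] V)} {H : Submodule K V} (w : fixer W H)
    (hw : ∀ v, w.1.1 v - v ∈ H) (k : ℕ) (v : V) :
    (w ^ k).1.1 v = v + k • (w.1.1 v - v) := by
  induction k with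
  | zero => simp
  | succ k ih =>
    rw [pow_succ']
    change w.1.1 ((w ^ k).1.1 v) = _
    rw [ih, map_add, map_nsmul, mem_fixer.1 w.2 _ (hw v), succ_nsmul]
    abel

/-- `W_H` acts faithfully on the line `V/H`. -/
theorem fixer_faithful [CharZero K] {W : Subgroup (V ≃ₗ[K] V)} [Finite W]
    {H : Submodule K V} (w : fixer W H) (hw : ∀ v, w.1.1 v - v ∈ H) :
    w = 1 := by
  have hpos := orderOf_pos w
  refine Subtype.ext (Subtype.ext (LinearEquiv.ext fun v => ?_))
  have h := fixer_pow w hw (orderOf w) v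
  rw [pow_orderOf_eq_one] at h
  have h3 : (orderOf w) • (w.1.1 v - v) = 0 := left_eq_add.1 h
  rw [← Nat.cast_smul_eq_nsmul K, smul_eq_zero] at h3
  have := h3.resolve_left (by exact_mod_cast hpos.ne')
  exact sub_eq_zero.1 this

theorem exp_card_ne_one {W : Subgroup (V ≃ₗ[K] V)} [Finite W] {H : Submodule K V} 
    (hH : H ∈ hyperplanes W) :
    Complex.exp (2 * Real.pi * Complex.I / (Nat.card (fixer W H) : ℕ)) ≠ 1 := by
  obtain ⟨-, s, hs, hs1, hsH⟩ := hH
  have hlt : 1 < Nat.card (fixer W H) := by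
    rw [Finite.one_lt_card_iff_nontrivial]
    exact ⟨⟨⟨s, hs⟩, mem_fixer.2 hsH⟩, 1, fun h => hs1 (congrArg (fun w => w.1.1) h)⟩
  exact (Complex.isPrimitiveRoot_exp _ (by omega)).ne_one hlt

end Groups

/-! ### Roots of unity -/

section Zeta

variable {K : Type*} [Field K] [NumberField K] [Algebra K ℂ]
  {V : Type*} [AddCommGroup V] [Module K V] {W : Subgroup (V ≃ₗ[K] V)} [Finite W]

theorem exists_zeta (C : Orbits W) :
    ∃ z : (NumberField.RingOfIntegers K)ˣ,
      algebraMap K ℂ ((z : NumberField.RingOfIntegers K) : K)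
        = Complex.exp (2 * Real.pi * Complex.I / ramification C) := by
  obtain ⟨⟨H, hH⟩, rfl⟩ := Quotient.exists_rep C
  change ∃ z : (NumberField.RingOfIntegers K)ˣ,
      algebraMap K ℂ ((z : NumberField.RingOfIntegers K) : K)
        = Complex.exp (2 * Real.pi * Complex.I / (Nat.card (fixer W H) : ℕ))
  set e := Nat.card (fixer W H) with he
  have he0 : e ≠ 0 := Nat.card_pos.ne'
  have : NeZero e := ⟨he0⟩
  have hrank : Module.finrank K (V ⧸ H) = 1 :=
    isSimpleModule_iff_finrank_eq_one.1 (isSimpleModule_iff_isCoatom.2 hH.1)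
  let f : fixer W H →* K :=
    { toFun := fun w => LinearMap.det (H.mapQ H (w.1.1 : V →ₗ[K] V) (fixer_le_comap w))
      map_one' := by
        have : H.mapQ H (((1 : fixer W H).1.1 : V ≃ₗ[K] V) : V →ₗ[K] V)
            (fixer_le_comap (1 : fixer W H)) = 1 := by
          ext v; rfl
        rw [this, map_one]
      map_mul' := fun w w' => by
        rw [← map_mul]
        congr 1
        ext v; rfl }
  have hf : Function.Injective f := by
    rw [injective_iff_map_eq_one]
    intro w hw
    apply fixer_faithful
    intro v
    obtain ⟨c, hc, -⟩ := LinearMap.existsUnique_eq_smul_id_of_finrank_eq_one hrank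
      (H.mapQ H (w.1.1 : V →ₗ[K] V) (fixer_le_comap w))
    have h1 : LinearMap.det (H.mapQ H (w.1.1 : V →ₗ[K] V) (fixer_le_comap w)) = 1 := hw
    rw [hc, LinearMap.det_smul, hrank, LinearMap.det_id, pow_one, mul_one] at h1
    have h2 := LinearMap.congr_fun hc (H.mkQ v)
    rw [h1, one_smul] at h2
    exact (Submodule.Quotient.eq H).1 h2
  have hcyc : IsCyclic (fixer W H) := isCyclic_of_injective_ringHom f hf
  obtain ⟨g, hg⟩ := IsCyclic.exists_ofOrder_eq_natCard (α := fixer W H)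
  have hprim : IsPrimitiveRoot (f g) e := by
    rw [he, ← hg, ← orderOf_injective f hf g]
    exact IsPrimitiveRoot.orderOf _
  obtain ⟨i, -, hi⟩ := (hprim.map_of_injective
    (algebraMap K ℂ).injective).eq_pow_of_pow_eq_one
      (Complex.isPrimitiveRoot_exp e he0).pow_eq_one
  have hx : (f g ^ i) ^ e = 1 := by rw [← pow_mul, mul_comm, pow_mul, hprim.pow_eq_one, one_pow]
  have hint : IsIntegral ℤ (f g ^ i) :=
    IsIntegral.of_pow (Nat.pos_of_ne_zero he0) (by rw [hx]; exact isIntegral_one)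
  refine ⟨Units.ofPowEqOne (⟨f g ^ i, hint⟩ : NumberField.RingOfIntegers K) e
    (Subtype.ext hx) he0, ?_⟩
  change algebraMap K ℂ (f g ^ i) = _
  rw [map_pow, hi]

/-- `ζ_{e_𝒞} = exp(2πi/e_𝒞)`, as a unit of the ring of integers of `K ⊆ ℂ`. -/
def zeta (C : Orbits W) : (NumberField.RingOfIntegers K)ˣ := (exists_zeta C).choose

end Zeta

/-! ### The regular part of the complexified representation and the braid group -/

section Topology

variable (K : Type*) [Field K] [Algebra K ℂ] (V : Type*) [AddCommGroup V] [Module K V]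

/-- The complex vector space `ℂ ⊗ V`, with its usual topology. -/
def Complexified : Type _ := ℂ ⊗[K] V

instance : AddCommGroup (Complexified K V) := inferInstanceAs (AddCommGroup (ℂ ⊗[K] V))
instance : Module ℂ (Complexified K V) := inferInstanceAs (Module ℂ (ℂ ⊗[K] V))
instance : TopologicalSpace (Complexified K V) := moduleTopology ℂ (Complexified K V)
instance : IsModuleTopology ℂ (Complexified K V) := ⟨rfl⟩
instance : ContinuousAdd (Complexified K V) := IsModuleTopology.toContinuousAdd ℂ _

variable {K V}

/-- The complexification of a linear automorphism of `V`. -/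
def complexify (w : V ≃ₗ[K] V) : Complexified K V →ₗ[ℂ] Complexified K V :=
  LinearMap.baseChange ℂ (w : V →ₗ[K] V)

/-- The complexification `ℂ ⊗ H` of a subspace `H` of `V`. -/
def complexSubspace (H : Submodule K V) : Submodule ℂ (Complexified K V) :=
  Submodule.baseChange ℂ H

theorem complexify_one : complexify (1 : V ≃ₗ[K] V) = LinearMap.id :=
  LinearMap.baseChange_id

theorem complexify_mul (w w' : V ≃ₗ[K] V) :
    complexify (w * w') = complexify w ∘ₗ complexify w' :=
  LinearMap.baseChange_comp _ _

theorem complexify_mem {w : V ≃ₗ[K] V} {H H' : Submodule K V}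
    (h : H.map (w : V →ₗ[K] V) ≤ H') {x : Complexified K V} (hx : x ∈ complexSubspace H) :
    complexify w x ∈ complexSubspace H' := by
  obtain ⟨y, rfl⟩ := hx
  change LinearMap.baseChange ℂ (w : V →ₗ[K] V) (LinearMap.baseChange ℂ H.subtype y) ∈
    Submodule.baseChange ℂ H'
  induction y using TensorProduct.induction_on with
  | zero => simp
  | add a b ha hb => rw [map_add, map_add]; exact add_mem ha hb
  | tmul c v => exact Submodule.tmul_mem_baseChange_of_mem c (h ⟨v.1, v.2, rfl⟩)

variable (W : Subgroup (V ≃ₗ[K] V))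

/-- `V^reg`, the complement in `ℂ ⊗ V` of the reflecting hyperplanes. -/
def Regular : Type _ :=
  {x : Complexified K V // ∀ H ∈ hyperplanes W, x ∉ complexSubspace H}

instance : TopologicalSpace (Regular W) := instTopologicalSpaceSubtype

variable {W}

theorem complexify_regular (w : W) (x : Regular W) :
    ∀ H ∈ hyperplanes W, complexify w.1 x.1 ∉ complexSubspace H := by
  intro H hH hx
  have hw : w.1⁻¹ ∈ W := W.inv_mem w.2
  refine x.2 _ (map_mem_hyperplanes hw hH) ?_
  have h := complexify_mem (w := w.1⁻¹) le_rfl hx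
  rwa [← LinearMap.comp_apply, ← complexify_mul, inv_mul_cancel, complexify_one] at h

instance : MulAction W (Regular W) where
  smul w x := ⟨complexify w.1 x.1, complexify_regular w x⟩
  one_smul x := Subtype.ext (by
    change complexify (1 : V ≃ₗ[K] V) x.1 = x.1
    rw [complexify_one]; rfl)
  mul_smul w w' x := Subtype.ext (by
    change complexify (w.1 * w'.1) x.1 = complexify w.1 (complexify w'.1 x.1)
    rw [complexify_mul]; rfl)

theorem coe_smul (w : W) (x : Regular W) : (w • x).1 = complexify w.1 x.1 := rfl

theorem continuous_act (w : W) : Continuous (fun x : Regular W => w • x) :=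
  Continuous.subtype_mk
    ((IsModuleTopology.continuous_of_linearMap (complexify w.1)).comp continuous_subtype_val) _

variable (W) in
/-- The quotient space `V^reg/W`. -/
abbrev RegularQuotient : Type _ := Quotient (MulAction.orbitRel W (Regular W))

/-- The image of a point of `V^reg` in `V^reg/W`. -/
abbrev toQuotient (x : Regular W) : RegularQuotient W :=
  Quotient.mk (MulAction.orbitRel W (Regular W)) x

theorem toQuotient_smul (w : W) (x : Regular W) : toQuotient (w • x) = toQuotient x :=
  Quotient.sound ⟨w, rfl⟩

/-- The braid group `B = π₁(V^reg/W, x₀)`. Mathlib's product on the fundamental group is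
`p * q = q.trans p` (first `q`, then `p`); passing to the opposite group, `p * q` is the class of
the loop that runs first through `p`, then through `q`. -/
abbrev BraidGroup (x₀ : Regular W) : Type _ :=
  (FundamentalGroup (RegularQuotient W) (toQuotient x₀))ᵐᵒᵖ

/-- The element of `B` defined by a path in `V^reg` from `x₀` to `w • x₀`. -/
def braidOfPath {x₀ : Regular W} (w : W) (γ : Path x₀ (w • x₀)) : BraidGroup x₀ :=
  MulOpposite.op (FundamentalGroup.fromPath (Path.Homotopic.Quotient.mk
    ((γ.map continuous_quotient_mk').cast rfl (toQuotient_smul w x₀).symm)))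

open Classical in
/-- The canonical surjection `B → W`: the class of a loop in `V^reg/W` goes to the `w ∈ W` such
that the lift of the loop starting at `x₀` ends at `w • x₀`. As `W` acts freely on `V^reg` (a
theorem of Steinberg), `V^reg → V^reg/W` is a covering with group `W`, so the second branch
never occurs. -/
def braidToGroup (x₀ : Regular W) : BraidGroup x₀ →* W :=
  if h : IsQuotientCoveringMap (toQuotient : Regular W → RegularQuotient W) W then
    (MulEquiv.opOp W).symm.toMonoidHom.comp
      (MonoidHom.op (h.fundamentalGroupToMulOpposite (x := toQuotient x₀) ⟨x₀, rfl⟩))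
  else 1

/-- The loop `t ↦ exp(2πit) x₀` in `V^reg`. -/
def fullTwistPath (x₀ : Regular W) : Path x₀ x₀ where
  toFun t := ⟨Complex.exp (2 * Real.pi * Complex.I * (t : ℝ)) • x₀.1, fun H hH h =>
    x₀.2 H hH (((complexSubspace H).smul_mem_iff (Complex.exp_ne_zero _)).1 h)⟩
  continuous_toFun := Continuous.subtype_mk (by fun_prop) _
  source' := Subtype.ext (by simp)
  target' := Subtype.ext (by simp [Complex.exp_two_pi_mul_I])

/-- The full twist `π ∈ B`, the class of the loop `t ↦ exp(2πit) x₀`. -/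
def fullTwist (x₀ : Regular W) : BraidGroup x₀ :=
  braidOfPath 1 ((fullTwistPath x₀).cast rfl (one_smul W x₀))

/-- `s` is the distinguished reflection of `W` with hyperplane `H`: the generator of `W_H` with
determinant `exp(2πi/e)`, `e = |W_H|`. -/
def IsDistinguished (s : W) (H : Submodule K V) : Prop :=
  s ∈ fixer W H ∧
    algebraMap K ℂ (LinearMap.det (s.1 : V →ₗ[K] V))
      = Complex.exp (2 * Real.pi * Complex.I / (Nat.card (fixer W H) : ℕ))

/-- For a reflection `s` whose non-trivial eigenvalue is `ζ = exp(2πi/e)`, write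
`x = x_H + x_⊥` with `s x_H = x_H` and `s x_⊥ = ζ x_⊥`; this is the point `x_H + z x_⊥`. -/
def rotate (s : W) (e : ℕ) (x : Complexified K V) (z : ℂ) : Complexified K V :=
  x + ((z - 1) / (Complex.exp (2 * Real.pi * Complex.I / e) - 1)) • (complexify s.1 x - x)

/-- `x` is close to the hyperplane `H` of `s`: the closed disc `{x_H + z x_⊥ : |z| ≤ 1}` meets
no reflecting hyperplane other than `H`, and meets `H` in its centre `x_H` only. -/
def IsCloseTo (s : W) (H : Submodule K V) (x : Regular W) : Prop :=
  (∀ z : ℂ, z ≠ 0 → ‖z‖ ≤ 1 → ∀ H' ∈ hyperplanes W,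
      rotate s (Nat.card (fixer W H)) x.1 z ∉ complexSubspace H') ∧
    ∀ H' ∈ hyperplanes W, H' ≠ H → rotate s (Nat.card (fixer W H)) x.1 0 ∉ complexSubspace H'

/-- The arc `t ↦ x_H + exp(2πit/e) x_⊥` from `x` to `s x`, for `x` close to `H`. -/
def arc [Finite W] {s : W} {H : Submodule K V} (hH : H ∈ hyperplanes W) {x : Regular W}
    (hx : IsCloseTo s H x) : Path x (s • x) where
  toFun t := ⟨rotate s (Nat.card (fixer W H)) x.1
      (Complex.exp ((2 * Real.pi * (t : ℝ) / (Nat.card (fixer W H) : ℕ) : ℝ) * Complex.I)),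
    hx.1 _ (Complex.exp_ne_zero _) (Complex.norm_exp_ofReal_mul_I _).le⟩
  continuous_toFun := Continuous.subtype_mk (by unfold rotate; fun_prop) _
  source' := Subtype.ext (by simp [rotate])
  target' := Subtype.ext (by
    have h : ((2 * Real.pi * ((1 : unitInterval) : ℝ) / (Nat.card (fixer W H) : ℕ) : ℝ) : ℂ)
        * Complex.I = 2 * Real.pi * Complex.I / (Nat.card (fixer W H) : ℕ) := by
      push_cast
      ring
    change rotate s _ x.1 (Complex.exp (_ * Complex.I)) = complexify s.1 x.1
    rw [h, rotate, div_self (sub_ne_zero.2 (exp_card_ne_one hH)), one_smul]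
    abel)

/-- `b ∈ B` is a generator of the monodromy around the image of a hyperplane of the orbit `C`:
it is the class of a path which follows some `γ` from `x₀` to a point `x` close to a hyperplane
`H ∈ C`, then the arc from `x` to `s x`, then the image under `s` of `γ` reversed. The set of these
elements is `𝐒_C`. -/
def IsMonodromyGenerator [Finite W] (x₀ : Regular W) (C : Orbits W) (b : BraidGroup x₀) : Prop :=
  ∃ (H : hyperplanes W) (s : W) (x : Regular W) (γ : Path x₀ x) (hx : IsCloseTo s H.1 x),
    orbitOf H = C ∧ IsDistinguished s H.1 ∧
      b = braidOfPath s ((γ.trans (arc H.2 hx)).trans (γ.map (continuous_act s)).symm)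

end Topology

/-! ### Symmetric algebras, irreducible characters and Schur elements -/

section Symmetric

/-- `t` is a symmetrizing form on the `R`-algebra `A`: a trace form whose associated bilinear form
`(a, a') ↦ t (a a')` is non-degenerate over `R`, i.e. identifies `A` with its `R`-dual. -/
def IsSymmetrizing {R A : Type*} [CommRing R] [Ring A] [Algebra R A] (t : A →ₗ[R] R) : Prop :=
  (∀ a a' : A, t (a * a') = t (a' * a)) ∧
    Function.Bijective (fun a : A => t ∘ₗ LinearMap.mulLeft R a)

/-- Extension of scalars of a linear form. -/
def extendForm {R A : Type*} [CommRing R] [Ring A] [Algebra R A] (S : Type*) [CommRing S]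
    [Algebra R S] (t : A →ₗ[R] R) : S ⊗[R] A →ₗ[S] S :=
  (TensorProduct.AlgebraTensorModule.rid R S S).toLinearMap ∘ₗ t.baseChange S

variable (F A : Type*) [Field F] [Ring A] [Algebra F A]

/-- `χ` is the character of an irreducible finite-dimensional representation of `A` over `F`. -/
def IsIrreducibleCharacter (χ : A →ₗ[F] F) : Prop :=
  ∃ (d : ℕ) (ρ : A →ₐ[F] Module.End F (Fin d → F)),
    0 < d ∧
    (∀ U : Submodule F (Fin d → F), (∀ a, ∀ v ∈ U, ρ a v ∈ U) → U = ⊥ ∨ U = ⊤) ∧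
    χ = LinearMap.trace F (Fin d → F) ∘ₗ ρ.toLinearMap

/-- The set `Irr(A)` of irreducible characters. -/
def Irr : Type _ := {χ : A →ₗ[F] F // IsIrreducibleCharacter F A χ}

variable {F A}

/-- `s` is the family of Schur elements of the form `t`: `t = ∑_χ (1/s_χ) χ`. -/
def IsSchurFamily (t : A →ₗ[F] F) (s : Irr F A → F) : Prop :=
  (∀ χ, s χ ≠ 0) ∧ t = ∑ᶠ χ : Irr F A, (s χ)⁻¹ • χ.1

open Classical in
/-- The Schur element `s_χ` of `χ` with respect to `t`. (The family `(s_χ)` exists and is unique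
when `A` is split semisimple and `t` is symmetrizing; otherwise the value may be meaningless.) -/
def schurElement (t : A →ₗ[F] F) (χ : Irr F A) : F :=
  if h : ∃ s : Irr F A → F, IsSchurFamily t s then h.choose χ else 0

end Symmetric

/-! ### The generic Hecke algebra -/

section Generic

variable {K : Type*} [Field K] {V : Type*} [AddCommGroup V] [Module K V]
  (W : Subgroup (V ≃ₗ[K] V))

/-- The Laurent polynomial ring `ℤ[𝐮, 𝐮⁻¹]`. -/
abbrev ParamRing : Type _ := AddMonoidAlgebra ℤ (ParamIndex W →₀ ℤ)

variable {W}

/-- The indeterminate `u_{𝒞,j}`. -/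
def param (i : ParamIndex W) : ParamRing W := AddMonoidAlgebra.single (Finsupp.single i 1) 1

/-- The ring homomorphism on `ℤ[𝐮, 𝐮⁻¹]` with `u_{𝒞,j} ↦ x_{𝒞,j}`. -/
def specialize {S : Type*} [CommRing S] (x : ParamIndex W → Sˣ) : ParamRing W →+* S :=
  (AddMonoidAlgebra.lift ℤ S (ParamIndex W →₀ ℤ)
    ((Units.coeHom S).comp (AddMonoidHom.toMultiplicativeLeft
      (Finsupp.liftAddHom fun i => zmultiplesHom (Additive Sˣ) (Additive.ofMul (x i)))))).toRingHom

theorem specialize_param {S : Type*} [CommRing S] (x : ParamIndex W → Sˣ) (i : ParamIndex W) :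
    specialize x (param i) = x i := by
  simp [specialize, param]

/-- The simultaneous inversion of the indeterminates. -/
def invertParams : ParamRing W →+* ParamRing W :=
  AddMonoidAlgebra.mapDomainRingHom ℤ (negAddMonoidHom : (ParamIndex W →₀ ℤ) →+ _)

variable [Algebra K ℂ] [Finite W] (x₀ : Regular W)

/-- The relations `(𝐬 - u_{𝒞,0}) ⋯ (𝐬 - u_{𝒞,e_𝒞-1}) = 0`, for `𝐬 ∈ 𝐒_𝒞`. -/
inductive HeckeRelation : MonoidAlgebra (ParamRing W) (BraidGroup x₀) →
    MonoidAlgebra (ParamRing W) (BraidGroup x₀) → Prop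
  | intro (C : Orbits W) (b : BraidGroup x₀) (hb : IsMonodromyGenerator x₀ C b) :
      HeckeRelation
        (List.ofFn fun j : Fin (ramification C) =>
          MonoidAlgebra.of (ParamRing W) (BraidGroup x₀) b
            - algebraMap (ParamRing W) _ (param ⟨C, j⟩)).prod 0

/-- The generic Hecke algebra `ℋ(W)`. -/
def HeckeAlgebra : Type _ := RingQuot (HeckeRelation x₀)

instance : Ring (HeckeAlgebra x₀) := inferInstanceAs (Ring (RingQuot (HeckeRelation x₀)))
instance : Algebra (ParamRing W) (HeckeAlgebra x₀) :=
  inferInstanceAs (Algebra (ParamRing W) (RingQuot (HeckeRelation x₀)))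

/-- The image in `ℋ(W)` of an element of `B`. -/
def braidImage (b : BraidGroup x₀) : HeckeAlgebra x₀ :=
  RingQuot.mkAlgHom (ParamRing W) (HeckeRelation x₀)
    (MonoidAlgebra.of (ParamRing W) (BraidGroup x₀) b)

open Classical in
/-- The properties that characterize the canonical symmetrizing form `t` of `ℋ(W)`:
it is symmetrizing; under `u_{𝒞,j} ↦ ζ_{e_𝒞}^j` it becomes the canonical form `w ↦ δ_{w,1}` of the
group algebra of `W`; and `t(b⁻¹)^* = t(bπ)/t(π)` for all `b ∈ B`, where `*` inverts the
indeterminates. -/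
structure IsCanonicalForm [NumberField K] (t : HeckeAlgebra x₀ →ₗ[ParamRing W] ParamRing W) :
    Prop where
  symmetrizing : IsSymmetrizing t
  specializes : ∀ b : BraidGroup x₀,
    specialize (fun i : ParamIndex W => zeta (K := K) i.1 ^ (i.2 : ℕ)) (t (braidImage x₀ b))
      = if braidToGroup x₀ b = 1 then 1 else 0
  twist : ∀ b : BraidGroup x₀,
    t (braidImage x₀ (fullTwist x₀)) * invertParams (t (braidImage x₀ b⁻¹))
      = t (braidImage x₀ (b * fullTwist x₀))

end Generic

/-! ### Cyclotomic Hecke algebras -/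

section Cyclotomic

variable {K : Type*} [Field K] [NumberField K] [Algebra K ℂ]
  {V : Type*} [AddCommGroup V] [Module K V] {W : Subgroup (V ≃ₗ[K] V)} [Finite W]

variable (K) in
/-- The number `|μ(K)|` of roots of unity in `K`. -/
abbrev rootsCard : ℕ := NumberField.Units.torsionOrder K

/-- The indeterminate of a Laurent polynomial ring, as a unit. -/
def laurentVar (R : Type*) [CommRing R] : R[T;T⁻¹]ˣ where
  val := LaurentPolynomial.T 1
  inv := LaurentPolynomial.T (-1)
  val_inv := by rw [← LaurentPolynomial.T_add]; simp
  inv_val := by rw [← LaurentPolynomial.T_add]; simp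

/-- The ring `ℤ_K[q, q⁻¹]`, regarded as a `ℤ[𝐮, 𝐮⁻¹]`-algebra through the cyclotomic
specialization `φ_𝐦 : u_{𝒞,j} ↦ ζ_{e_𝒞}^j q^{m_{𝒞,j}}`. -/
def CyclotomicRing (_m : Weights W) : Type _ := (NumberField.RingOfIntegers K)[T;T⁻¹]

instance (m : Weights W) : CommRing (CyclotomicRing m) :=
  inferInstanceAs (CommRing (NumberField.RingOfIntegers K)[T;T⁻¹])

instance (m : Weights W) : Algebra (ParamRing W) (CyclotomicRing m) :=
  (specialize (S := (NumberField.RingOfIntegers K)[T;T⁻¹]) fun i =>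
    Units.map (LaurentPolynomial.C : NumberField.RingOfIntegers K →+* _).toMonoidHom
        (zeta i.1 ^ (i.2 : ℕ))
      * laurentVar (NumberField.RingOfIntegers K) ^ m i.1 i.2).toAlgebra

variable (K) in
/-- The indeterminate `y` as a unit of the field `K(y)`. -/
def yVar : (RatFunc K)ˣ := Units.mk0 RatFunc.X RatFunc.X_ne_zero

variable (K) in
/-- The inclusion `ℤ_K → K(y)`. -/
def intToRatFunc : NumberField.RingOfIntegers K →+* RatFunc K :=
  (algebraMap K (RatFunc K)).comp (algebraMap (NumberField.RingOfIntegers K) K)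

/-- `ℤ_K[q, q⁻¹] ⊆ K(y)`, where `q = y^|μ(K)|`. -/
instance (m : Weights W) : Algebra (CyclotomicRing m) (RatFunc K) :=
  (LaurentPolynomial.eval₂ (intToRatFunc K) (yVar K ^ rootsCard K)).toAlgebra

variable (x₀ : Regular W) (m : Weights W)

/-- The cyclotomic Hecke algebra `ℋ_𝐦` over `ℤ_K[q, q⁻¹]`. -/
abbrev CyclotomicHecke : Type _ := CyclotomicRing m ⊗[ParamRing W] HeckeAlgebra x₀

/-- The algebra `K(y)ℋ_𝐦`. -/
abbrev CyclotomicHeckeField : Type _ := RatFunc K ⊗[CyclotomicRing m] CyclotomicHecke x₀ m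

/-- The form `t_φ` on `K(y)ℋ_𝐦` obtained from a form `t` on `ℋ(W)`. -/
def cyclotomicForm (t : HeckeAlgebra x₀ →ₗ[ParamRing W] ParamRing W) :
    CyclotomicHeckeField x₀ m →ₗ[RatFunc K] RatFunc K :=
  extendForm (RatFunc K) (extendForm (CyclotomicRing m) t)

variable (W) in
/-- The set `Λ`: the irreducible characters of `W` over `K`. -/
abbrev Labels : Type _ := Irr K (MonoidAlgebra K W)

/-- `χ ∈ Irr(K(y)ℋ_𝐦)` specializes to `lam ∈ Irr(W)` under `y ↦ 1`: for all `b ∈ B` the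
value of `χ` at the image of `b` is a Laurent polynomial `P(y)` over `ℤ_K`, and `P(1)` is the value
of `lam` at the image of `b` in `W`. -/
def SpecializesTo (χ : Irr (RatFunc K) (CyclotomicHeckeField x₀ m)) (lam : Labels W) : Prop :=
  ∀ b : BraidGroup x₀, ∃ P : (NumberField.RingOfIntegers K)[T;T⁻¹],
    χ.1 (1 ⊗ₜ[CyclotomicRing m] (1 ⊗ₜ[ParamRing W] braidImage x₀ b))
        = LaurentPolynomial.eval₂ (intToRatFunc K) (yVar K) P ∧
      LaurentPolynomial.eval₂ (algebraMap (NumberField.RingOfIntegers K) K) 1 P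
        = lam.1 (MonoidAlgebra.of K W (braidToGroup x₀ b))

open Classical in
/-- The Schur element `s_λ^{φ_𝐦} ∈ K(y)` of the irreducible representation `V_φ^λ` of `K(y)ℋ_𝐦`
which specializes to `λ`, with respect to the specialized form `t_φ`. (By the theorem of Malle
on the splitting of `K(y)ℋ_𝐦` and Tits' deformation theorem, `V_φ^λ` exists and is unique.) -/
def cyclotomicSchurElement (t : HeckeAlgebra x₀ →ₗ[ParamRing W] ParamRing W) (lam : Labels W) :
    RatFunc K :=
  if h : ∃ χ, SpecializesTo x₀ m χ lam then
    schurElement (cyclotomicForm x₀ m t) h.choose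
  else 0

/-- The valuation at `y` of an element of `K(y)`: its order at `0`. -/
def valY (f : RatFunc K) : ℤ :=
  (f.num.rootMultiplicity 0 : ℤ) - (f.denom.rootMultiplicity 0 : ℤ)

/-- The function `a`: `a_λ^{φ_𝐦} = - val_q(s_λ^{φ_𝐦})`, where `val_q = val_y / |μ(K)|`. -/
def aFunction (t : HeckeAlgebra x₀ →ₗ[ParamRing W] ParamRing W) (lam : Labels W) : ℚ :=
  -((valY (cyclotomicSchurElement x₀ m t lam) : ℚ) / rootsCard K)

end Cyclotomic

end ReflectionHecke

end

noncomputable section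

namespace ReflectionHecke

/-! ### Maps out of the generic Hecke algebra -/

section HeckeHom

variable {K : Type*} [Field K] {V : Type*} [AddCommGroup V] [Module K V]
  {W : Subgroup (V ≃ₗ[K] V)} [Algebra K ℂ] [Finite W] {x₀ : Regular W}

/-! Adding `n` multiplies all the `φ_𝐦(u_{C,j})` of one orbit `C` by the same unit `y_C = q^{n_C}`.
Suppose that `B` has characters `ℓ_C : B → ℤ` with value 1 on the monodromy generators of `C` and 0
on those of the other orbits. Then `b ↦ ∏ y_C^{ℓ_C(b)} b` respects the Hecke relations and defines
an isomorphism from `K(y)ℋ_{𝐦+𝐧}` to `K(y)ℋ_𝐦` (`exists_cyclotomicEquiv`). The scalars are powers of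
`y`, equal to 1 at `y = 1`, so labels in `Λ` are preserved. If moreover `t(b)` is homogeneous of
degree `ℓ_C(b)` in the `u_{C,j}` for every `C`, then the isomorphism matches the two specialized
forms (`map_eq_prod_mul_of_homogeneous`), hence the Schur elements.

The `ℓ_C` come from algebra (`exists_length`). With `u_{C,j} ↦ X` and the other indeterminates sent
to 1, the degree in `X` of the norm of `b` on the specialized `ℋ(W)` is a character `L` with value
`N = |W|` on the generators of `C` (`exists_degree`). Homogeneity, in the form `N deg_C = L(b)`,
follows from the uniqueness of `t` (`canonicalForm_homogeneous`): twisting `t` by `b ↦ 𝐮^{L(b)μ}`,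
for a monomial `𝐮^μ` of degree 0 which specializes to 1, gives a form with the same three
properties. The resulting functional equation, together with the finiteness of supports, fixes the
degrees. Finally `N` divides `L` (`dvd_degree`): on the kernel of `B → W` because `t(b) ≠ 0` there,
and elsewhere because the reflections of `W` lift to products of monodromy generators. So `ℓ_C =
L/N`.

The Schur elements and the representation attached to `λ` are obtained by choice, so their
uniqueness is needed too. Both follow from non-degeneracy of the trace of the regular
representation, which holds for the group algebra and hence generically
(`groupHom_traceGram_ne_zero`). It makes irreducible characters linearly independent
(`linearIndependent_irr`) and determined by their value at `y = 1` (`irr_eq_of_reduction_eq`). -/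

variable (x₀) in
/-- The quotient map from the group algebra of `B` onto `ℋ(W)`. -/
def heckeMk : MonoidAlgebra (ParamRing W) (BraidGroup x₀) →ₐ[ParamRing W] HeckeAlgebra x₀ :=
  RingQuot.mkAlgHom (ParamRing W) (HeckeRelation x₀)

theorem heckeMk_of (b : BraidGroup x₀) :
    heckeMk x₀ (MonoidAlgebra.of (ParamRing W) (BraidGroup x₀) b) = braidImage x₀ b := rfl

theorem braidImage_one : braidImage x₀ 1 = 1 := by
  rw [← heckeMk_of, map_one, map_one]

theorem braidImage_mul (b c : BraidGroup x₀) :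
    braidImage x₀ (b * c) = braidImage x₀ b * braidImage x₀ c := by
  rw [← heckeMk_of, map_mul, map_mul, heckeMk_of, heckeMk_of]

theorem hecke_induction {p : HeckeAlgebra x₀ → Prop} (h : HeckeAlgebra x₀)
    (braid : ∀ b, p (braidImage x₀ b)) (add : ∀ x y, p x → p y → p (x + y))
    (smul : ∀ (r : ParamRing W) x, p x → p (r • x)) : p h := by
  obtain ⟨a, ha⟩ : ∃ a, heckeMk x₀ a = h :=
    RingQuot.mkAlgHom_surjective (ParamRing W) (HeckeRelation x₀) h
  rw [← ha]
  clear ha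
  induction a using MonoidAlgebra.induction_on with
  | of b => exact braid b
  | add x y hx hy => rw [map_add]; exact add _ _ hx hy
  | smul r x hx => rw [map_smul]; exact smul _ _ hx

theorem hecke_relation {C : Orbits W} {b : BraidGroup x₀} (hb : IsMonodromyGenerator x₀ C b) :
    (List.ofFn fun j : Fin (ramification C) => braidImage x₀ b
      - algebraMap (ParamRing W) (HeckeAlgebra x₀) (param ⟨C, j⟩)).prod = 0 := by
  have h : heckeMk x₀ _ = heckeMk x₀ _ :=
    RingQuot.mkAlgHom_rel (ParamRing W) (HeckeRelation.intro (x₀ := x₀) C b hb)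
  rw [map_zero, map_list_prod, List.map_ofFn] at h
  refine Eq.trans (congrArg (fun f => (List.ofFn f).prod) (funext fun j => ?_)) h
  rw [Function.comp_apply, map_sub, AlgHom.commutes, heckeMk_of]

/-- The universal property of `ℋ(W)`. -/
theorem exists_heckeHom {S E : Type*} [CommRing S] [Ring E] [Algebra S E] (φ : ParamRing W →+* S)
    (f : BraidGroup x₀ →* E)
    (hf : ∀ C b, IsMonodromyGenerator x₀ C b →
      (List.ofFn fun j : Fin (ramification C) =>
        f b - algebraMap S E (φ (param ⟨C, j⟩))).prod = 0) :
    ∃ g : HeckeAlgebra x₀ →+* E,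
      (∀ r h, g (r • h) = φ r • g h) ∧ ∀ b, g (braidImage x₀ b) = f b := by
  -- Viewing `E` as an algebra through `φ` turns semilinear maps into algebra maps, to which the
  -- universal property of the quotient applies.
  let _ : Algebra (ParamRing W) E := Algebra.compHom E φ
  have hrel : ∀ ⦃x y⦄, HeckeRelation x₀ x y →
      MonoidAlgebra.lift (ParamRing W) E (BraidGroup x₀) f x
        = MonoidAlgebra.lift (ParamRing W) E (BraidGroup x₀) f y := by
    rintro _ _ ⟨C, b, hb⟩
    rw [map_zero, map_list_prod, List.map_ofFn]
    refine Eq.trans (congrArg (fun f => (List.ofFn f).prod) (funext fun j => ?_)) (hf C b hb)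
    rw [Function.comp_apply, map_sub, AlgHom.commutes, MonoidAlgebra.lift_of]
    rfl
  let g : HeckeAlgebra x₀ →ₐ[ParamRing W] E := RingQuot.liftAlgHom (ParamRing W) ⟨_, hrel⟩
  refine ⟨g.toRingHom, fun r h => map_smul g r h, fun b => ?_⟩
  exact (RingQuot.liftAlgHom_mkAlgHom_apply (ParamRing W) _ hrel _).trans
    (MonoidAlgebra.lift_of _ _)

theorem prod_ofFn_smul {S E : Type*} [CommRing S] [Ring E] [Algebra S E] (c : S) {e : ℕ}
    (x : Fin e → E) : (List.ofFn fun j => c • x j).prod = c ^ e • (List.ofFn x).prod := by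
  have h := List.smul_prod (List.ofFn x) c
  rw [List.length_ofFn] at h
  rw [h, List.map_ofFn]
  rfl

/-- Twisting a homomorphism from `ℋ(W)` by a linear character `c` of `B`. -/
theorem exists_heckeHom_twist {S E : Type*} [CommRing S] [Ring E] [Algebra S E]
    (φ φ' : ParamRing W →+* S) (g : HeckeAlgebra x₀ →+* E) (hg : ∀ r h, g (r • h) = φ r • g h)
    (c : BraidGroup x₀ →* S)
    (hc : ∀ C b, IsMonodromyGenerator x₀ C b → ∀ j,
      φ' (param ⟨C, j⟩) = c b * φ (param ⟨C, j⟩)) :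
    ∃ g' : HeckeAlgebra x₀ →+* E,
      (∀ r h, g' (r • h) = φ' r • g' h) ∧
        ∀ b, g' (braidImage x₀ b) = c b • g (braidImage x₀ b) := by
  refine exists_heckeHom φ'
    { toFun := fun b => c b • g (braidImage x₀ b)
      map_one' := by simp [braidImage_one]
      map_mul' := fun b b' => by
        rw [braidImage_mul, map_mul, map_mul, smul_mul_smul_comm] } ?_
  intro C b hb
  have h := congrArg g (hecke_relation hb)
  rw [map_zero, map_list_prod, List.map_ofFn] at h
  -- Both terms of each factor acquire `c b`, so the new relation is `(c b)^e` times the old one.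
  have h2 : (fun j : Fin (ramification C) =>
      c b • g (braidImage x₀ b) - algebraMap S E (φ' (param ⟨C, j⟩)))
      = fun j => c b • (g (braidImage x₀ b) - algebraMap S E (φ (param ⟨C, j⟩))) := by
    funext j
    rw [hc C b hb j, smul_sub, Algebra.algebraMap_eq_smul_one, Algebra.algebraMap_eq_smul_one,
      smul_smul]
  change (List.ofFn fun j : Fin (ramification C) =>
      c b • g (braidImage x₀ b) - algebraMap S E (φ' (param ⟨C, j⟩))).prod = 0
  rw [h2, prod_ofFn_smul]
  refine (congrArg (fun x => c b ^ ramification C • x) ?_).trans (smul_zero _)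
  refine Eq.trans (congrArg (fun f => (List.ofFn f).prod) (funext fun j => ?_)) h
  simp only [Function.comp_apply, map_sub, Algebra.algebraMap_eq_smul_one, hg, map_one]

end HeckeHom

/-! ### Degrees of braids -/

section Degree

variable {K : Type*} [Field K] {V : Type*} [AddCommGroup V] [Module K V]
  {W : Subgroup (V ≃ₗ[K] V)} [Algebra K ℂ] [Finite W] {x₀ : Regular W}

/-- Multiplication by `x - a` is nilpotent, so its characteristic polynomial is a power of the
variable; its value at `x` is `det (x - (x - a))`, the norm of `a`. -/
theorem norm_eq_pow_of_sub_pow_eq_zero {F A : Type*} [Field F] [Ring A] [Algebra F A]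
    [Module.Finite F A] (a : A) (x : F) (e : ℕ) (h : (a - algebraMap F A x) ^ e = 0) :
    Algebra.norm F a = x ^ Module.finrank F A := by
  have hn : IsNilpotent (Algebra.lmul F A (algebraMap F A x - a)) := by
    refine IsNilpotent.map ⟨e, ?_⟩ _
    rw [← neg_sub, neg_pow, h, mul_zero]
  have h1 := LinearMap.eval_charpoly (Algebra.lmul F A (algebraMap F A x - a)) x
  rw [hn.charpoly_eq_X_pow_finrank] at h1
  rw [Algebra.norm_apply]
  simp only [Polynomial.eval_pow, Polynomial.eval_X] at h1
  rw [h1]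
  congr 1
  ext y
  simp [Algebra.smul_def]

-- Under `u_{C,j} ↦ X` and `u_{C',j} ↦ 1` for `C' ≠ C`, the Hecke relation of a generator `b`
-- becomes `(b - X)^e = 0` or `(b - 1)^e = 0`, so its norm is a power of `X` or 1. Braids are units,
-- so the degree of the norm is additive on `B`.
open Classical in
theorem exists_degree [Module.Free (ParamRing W) (HeckeAlgebra x₀)]
    [Module.Finite (ParamRing W) (HeckeAlgebra x₀)] (C : Orbits W) :
    ∃ L : BraidGroup x₀ →* Multiplicative ℤ, ∀ C' b, IsMonodromyGenerator x₀ C' b →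
      L b = Multiplicative.ofAdd
        (if C' = C then (Module.finrank (ParamRing W) (HeckeAlgebra x₀) : ℤ) else 0) := by
  let X : (RatFunc ℚ)ˣ := Units.mk0 RatFunc.X RatFunc.X_ne_zero
  let x : ParamIndex W → (RatFunc ℚ)ˣ := fun i => if i.1 = C then X else 1
  let _ : Algebra (ParamRing W) (RatFunc ℚ) := (specialize x).toAlgebra
  let A := RatFunc ℚ ⊗[ParamRing W] HeckeAlgebra x₀
  let j : HeckeAlgebra x₀ →ₐ[ParamRing W] A := Algebra.TensorProduct.includeRight
  have hu : ∀ b, Algebra.norm (RatFunc ℚ) (j (braidImage x₀ b)) ≠ 0 := by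
    intro b hb
    have h1 : Algebra.norm (RatFunc ℚ) (j (braidImage x₀ (b * b⁻¹))) = 1 := by
      rw [mul_inv_cancel, braidImage_one, map_one, map_one]
    rw [braidImage_mul, map_mul, map_mul, hb, zero_mul] at h1
    exact zero_ne_one h1
  refine ⟨
    { toFun := fun b => Multiplicative.ofAdd
        (RatFunc.intDegree (Algebra.norm (RatFunc ℚ) (j (braidImage x₀ b))))
      map_one' := by
        rw [braidImage_one, map_one, map_one, RatFunc.intDegree_one, ofAdd_zero]
      map_mul' := fun b b' => by
        rw [braidImage_mul, map_mul, map_mul, RatFunc.intDegree_mul (hu b) (hu b'), ofAdd_add] },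
    fun C' b hb => ?_⟩
  change Multiplicative.ofAdd
    (RatFunc.intDegree (Algebra.norm (RatFunc ℚ) (j (braidImage x₀ b)))) = _
  congr 1
  let y : (RatFunc ℚ)ˣ := if C' = C then X else 1
  have hrel : (j (braidImage x₀ b) - algebraMap (RatFunc ℚ) A y) ^ ramification C' = 0 := by
    have h := congrArg j (hecke_relation hb)
    rw [map_zero, map_list_prod, List.map_ofFn] at h
    rw [← h]
    have : (j ∘ fun i : Fin (ramification C') => braidImage x₀ b
        - algebraMap (ParamRing W) (HeckeAlgebra x₀) (param ⟨C', i⟩))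
        = fun _ => j (braidImage x₀ b) - algebraMap (RatFunc ℚ) A y := by
      funext i
      simp only [Function.comp_apply, map_sub, AlgHom.commutes]
      rw [IsScalarTower.algebraMap_apply (ParamRing W) (RatFunc ℚ) A]
      congr 2
      exact specialize_param x ⟨C', i⟩
    rw [this, List.ofFn_const, List.prod_replicate]
  rw [norm_eq_pow_of_sub_pow_eq_zero _ _ _ hrel, Module.finrank_baseChange]
  have hpow : ∀ k : ℕ, RatFunc.intDegree ((RatFunc.X : RatFunc ℚ) ^ k) = k := by
    intro k
    induction k with
    | zero => simp
    | succ k ih =>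
      rw [pow_succ, RatFunc.intDegree_mul (pow_ne_zero _ RatFunc.X_ne_zero) RatFunc.X_ne_zero, ih]
      simp
  by_cases hC : C' = C
  · simp only [y, if_pos hC]
    exact hpow _
  · simp only [y, if_neg hC, Units.val_one, one_pow, RatFunc.intDegree_one]

end Degree

/-! ### Homogeneity of the canonical form -/

section Homogeneity

variable {K : Type*} [Field K] {V : Type*} [AddCommGroup V] [Module K V]
  {W : Subgroup (V ≃ₗ[K] V)}

/-- Each orbit thus has two distinct indeterminates `u_{C,0}` and `u_{C,1}`, whose quotient supplies
monomials of degree 0. -/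
theorem one_lt_ramification [Finite W] (C : Orbits W) : 1 < ramification C := by
  obtain ⟨⟨H, -, s, hs, hs1, hsH⟩, rfl⟩ := Quotient.exists_rep C
  change 1 < Nat.card (fixer W H)
  rw [Finite.one_lt_card_iff_nontrivial]
  exact ⟨⟨⟨s, hs⟩, mem_fixer.2 hsH⟩, 1, fun h => hs1 (congrArg (fun w => w.1.1) h)⟩

open Classical in
/-- The total degree of a monomial in the indeterminates attached to the orbit `C`. -/
def orbitDegree (C : Orbits W) : (ParamIndex W →₀ ℤ) →+ ℤ :=
  Finsupp.liftAddHom fun i => if i.1 = C then AddMonoidHom.id ℤ else 0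

open Classical in
theorem orbitDegree_single (C : Orbits W) (i : ParamIndex W) (k : ℤ) :
    orbitDegree C (Finsupp.single i k) = if i.1 = C then k else 0 := by
  rw [orbitDegree, Finsupp.liftAddHom_apply_single]
  split_ifs <;> rfl

/-- The additive map `a ↦ a + N |a|_C μ` on exponents. -/
def shiftExponent (C : Orbits W) (N : ℤ) (μ : ParamIndex W →₀ ℤ) :
    (ParamIndex W →₀ ℤ) →+ (ParamIndex W →₀ ℤ) :=
  AddMonoidHom.id _ +
    (zmultiplesHom _ μ).comp ((AddMonoidHom.mulLeft N).comp (orbitDegree C))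

theorem shiftExponent_apply (C : Orbits W) (N : ℤ) (μ a : ParamIndex W →₀ ℤ) :
    shiftExponent C N μ a = a + (N * orbitDegree C a) • μ := rfl

/-- The endomorphism of `ℤ[𝐮, 𝐮⁻¹]` which multiplies every `u_{C,j}` by `(𝐮^μ)^N`. -/
def orbitScale (C : Orbits W) (N : ℤ) (μ : ParamIndex W →₀ ℤ) : ParamRing W →+* ParamRing W :=
  AddMonoidAlgebra.mapDomainRingHom ℤ (shiftExponent C N μ)

theorem orbitScale_single (C : Orbits W) (N : ℤ) (μ a : ParamIndex W →₀ ℤ) (r : ℤ) :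
    orbitScale C N μ (AddMonoidAlgebra.single a r)
      = AddMonoidAlgebra.single (a + (N * orbitDegree C a) • μ) r :=
  AddMonoidAlgebra.mapDomain_single

theorem paramRing_hom_ext {S : Type*} [CommRing S] {f g : ParamRing W →+* S}
    (h : ∀ a, f (AddMonoidAlgebra.single a 1) = g (AddMonoidAlgebra.single a 1)) : f = g := by
  refine AddMonoidAlgebra.ringHom_ext (fun r => ?_) h
  have h1 : (AddMonoidAlgebra.single 0 r : ParamRing W) = (r : ParamRing W) :=
    (AddMonoidAlgebra.intCast_def r).symm
  rw [h1, map_intCast, map_intCast]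

/-- Since `μ` has degree 0, the shift of an exponent leaves its degree alone, so the opposite shift
undoes it. -/
theorem orbitScale_neg_apply {C : Orbits W} {μ : ParamIndex W →₀ ℤ} (hμ : orbitDegree C μ = 0)
    (N : ℤ) (r : ParamRing W) : orbitScale C (-N) μ (orbitScale C N μ r) = r := by
  refine RingHom.congr_fun (f := (orbitScale C (-N) μ).comp (orbitScale C N μ))
    (g := RingHom.id _) (paramRing_hom_ext fun a => ?_) r
  simp [orbitScale_single, hμ]

/-- `orbitScale` as an automorphism, when `μ` has degree `0`. -/
def orbitScaleEquiv {C : Orbits W} {μ : ParamIndex W →₀ ℤ} (hμ : orbitDegree C μ = 0) (N : ℤ) :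
    ParamRing W ≃+* ParamRing W :=
  RingEquiv.ofRingHom (orbitScale C N μ) (orbitScale C (-N) μ)
    (RingHom.ext fun r => by simpa using orbitScale_neg_apply hμ (-N) r)
    (RingHom.ext fun r => orbitScale_neg_apply hμ N r)

theorem invertParams_single (a : ParamIndex W →₀ ℤ) (r : ℤ) :
    invertParams (AddMonoidAlgebra.single a r) = AddMonoidAlgebra.single (-a) r :=
  AddMonoidAlgebra.mapDomain_single

theorem invertParams_orbitScale (C : Orbits W) (N : ℤ) (μ : ParamIndex W →₀ ℤ) (r : ParamRing W) :
    invertParams (orbitScale C N μ r) = orbitScale C N μ (invertParams r) := by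
  refine RingHom.congr_fun (f := invertParams.comp (orbitScale C N μ))
    (g := (orbitScale C N μ).comp invertParams) (paramRing_hom_ext fun a => ?_) r
  simp only [RingHom.comp_apply, orbitScale_single, invertParams_single, map_neg]
  congr 1
  rw [neg_add, mul_neg, neg_smul]

/-- The monomials in the kernel of a specialization form a subgroup. -/
theorem specialize_zsmul {S : Type*} [CommRing S] (x : ParamIndex W → Sˣ)
    {μ : ParamIndex W →₀ ℤ} (hμ : specialize x (AddMonoidAlgebra.single μ 1) = 1) (k : ℤ) :
    specialize x (AddMonoidAlgebra.single (k • μ) 1) = 1 := by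
  let f : Multiplicative (ParamIndex W →₀ ℤ) →* S :=
    (specialize x : ParamRing W →* S).comp (AddMonoidAlgebra.of ℤ _)
  exact f.ker.zpow_mem (x := Multiplicative.ofAdd μ) hμ k

theorem specialize_orbitScale {S : Type*} [CommRing S] (x : ParamIndex W → Sˣ)
    {μ : ParamIndex W →₀ ℤ} (hμ : specialize x (AddMonoidAlgebra.single μ 1) = 1)
    (C : Orbits W) (N : ℤ) (r : ParamRing W) :
    specialize x (orbitScale C N μ r) = specialize x r := by
  refine RingHom.congr_fun (f := (specialize x).comp (orbitScale C N μ))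
    (g := specialize x) (paramRing_hom_ext fun a => ?_) r
  rw [RingHom.comp_apply, orbitScale_single, ← mul_one (1 : ℤ),
    ← AddMonoidAlgebra.single_mul_single, map_mul, specialize_zsmul x hμ]
  simp

theorem specialize_single_sub {S : Type*} [CommRing S] (x : ParamIndex W → Sˣ) (i j : ParamIndex W)
    (e : ℕ) (hi : x i ^ e = 1) (hj : x j ^ e = 1) :
    specialize x
      (AddMonoidAlgebra.single (Finsupp.single i (e : ℤ) - Finsupp.single j (e : ℤ)) 1) = 1 := by
  let f : Multiplicative (ParamIndex W →₀ ℤ) →* S :=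
    (specialize x : ParamRing W →* S).comp (AddMonoidAlgebra.of ℤ _)
  have key : ∀ i, x i ^ e = 1 → Multiplicative.ofAdd (Finsupp.single i (e : ℤ)) ∈ f.ker := by
    intro i hi
    have h1 : Multiplicative.ofAdd (Finsupp.single i (e : ℤ))
        = Multiplicative.ofAdd (Finsupp.single i (1 : ℤ)) ^ e := by
      rw [← ofAdd_nsmul]
      simp
    rw [MonoidHom.mem_ker, h1, map_pow]
    have h2 : f (Multiplicative.ofAdd (Finsupp.single i (1 : ℤ))) = x i := specialize_param x i
    rw [h2, ← Units.val_pow_eq_pow_val, hi, Units.val_one]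
  exact f.ker.div_mem (key i hi) (key j hj)

/-- Comparing coefficients, `p.coeff` is invariant under `a ↦ a + (N deg a - L) μ`. This translation
preserves the degree, so its iterates move by a constant vector; if that vector is nonzero, a
nonzero coefficient would be repeated infinitely often. -/
theorem coeff_eq_zero_of_orbitScale_eq {C : Orbits W} {μ : ParamIndex W →₀ ℤ}
    (hμ : orbitDegree C μ = 0) (hμ0 : μ ≠ 0) {N L : ℤ} {p : ParamRing W}
    (hp : orbitScale C N μ p = AddMonoidAlgebra.single (L • μ) 1 * p)
    {a : ParamIndex W →₀ ℤ} (ha : N * orbitDegree C a ≠ L) : p.coeff a = 0 := by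
  have hinj : Function.Injective (shiftExponent C N μ) := by
    intro a b hab
    rw [shiftExponent_apply, shiftExponent_apply] at hab
    have h1 := congrArg (orbitDegree C) hab
    simp only [map_add, map_zsmul, hμ, smul_zero, add_zero] at h1
    rw [h1] at hab
    exact add_right_cancel hab
  have step : ∀ a, p.coeff (a + (N * orbitDegree C a - L) • μ) = p.coeff a := by
    intro a
    have h1 := congrArg (fun q => q.coeff (shiftExponent C N μ a)) hp
    have h2 : (orbitScale C N μ p).coeff (shiftExponent C N μ a) = p.coeff a :=
      Finsupp.mapDomain_apply hinj p.coeff a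
    simp only [h2, AddMonoidAlgebra.coeff_single_mul_apply, one_mul] at h1
    rw [h1, shiftExponent_apply]
    congr 1
    rw [sub_smul]
    abel
  have hd : N * orbitDegree C a - L ≠ 0 := sub_ne_zero.2 ha
  have iter : ∀ k : ℕ, p.coeff (a + (k : ℤ) • (N * orbitDegree C a - L) • μ) = p.coeff a := by
    intro k
    induction k with
    | zero => simp
    | succ k ih =>
      rw [← ih, ← step (a + (k : ℤ) • (N * orbitDegree C a - L) • μ)]
      congr 1
      simp only [map_add, map_zsmul, hμ, smul_zero, add_zero, Nat.cast_succ, add_smul, one_smul]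
      abel
  by_contra h
  have hinj2 : Function.Injective fun k : ℕ => a + (k : ℤ) • (N * orbitDegree C a - L) • μ := by
    intro k l hkl
    have h1 := add_left_cancel hkl
    have h2 := smul_left_injective ℤ (smul_ne_zero hd hμ0) h1
    exact_mod_cast h2
  refine Set.infinite_of_injective_forall_mem (s := (p.coeff.support : Set (ParamIndex W →₀ ℤ)))
    hinj2 (fun k => ?_) (Finset.finite_toSet _)
  rw [Finset.mem_coe, Finsupp.mem_support_iff, iter k]
  exact h

/-- Transport of structure: the element representing `ψ` for `t'` is the preimage under `Φ` of the
one representing `θ ∘ ψ ∘ Φ⁻¹` for `t`. -/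
theorem IsSymmetrizing.of_semilinear {R A : Type*} [CommRing R] [Ring A] [Algebra R A]
    {t t' : A →ₗ[R] R} (ht : IsSymmetrizing t) (θ : R ≃+* R) (Φ : A ≃+* A)
    (hΦ : ∀ r a, Φ (r • a) = θ r • Φ a) (ht' : ∀ a, θ (t' a) = t (Φ a)) : IsSymmetrizing t' := by
  refine ⟨fun a b => θ.injective ?_, fun a b hab => Φ.injective (ht.2.1 ?_), fun ψ => ?_⟩
  · rw [ht', ht', map_mul Φ, map_mul Φ, ht.1]
  · refine LinearMap.ext fun y => ?_
    have h1 := congrArg θ (LinearMap.congr_fun hab (Φ.symm y))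
    simpa [ht'] using h1
  · obtain ⟨a, ha⟩ := ht.2.2
      { toFun := fun y => θ (ψ (Φ.symm y))
        map_add' := fun x y => by simp
        map_smul' := fun r y => by
          have : Φ.symm (r • y) = θ.symm r • Φ.symm y := Φ.injective (by simp [hΦ])
          simp [this] }
    refine ⟨Φ.symm a, LinearMap.ext fun y => θ.injective ?_⟩
    have h1 := LinearMap.congr_fun ha (Φ y)
    simpa [ht'] using h1

variable [Algebra K ℂ] {x₀ : Regular W}

/-- The linear character `b ↦ 𝐮^(L(b) μ)` of `B`. -/
def monomialCharacter (L : BraidGroup x₀ →* Multiplicative ℤ) (μ : ParamIndex W →₀ ℤ) :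
    BraidGroup x₀ →* ParamRing W :=
  (AddMonoidAlgebra.of ℤ (ParamIndex W →₀ ℤ)).comp
    ((AddMonoidHom.toMultiplicative (zmultiplesHom (ParamIndex W →₀ ℤ) μ)).comp L)

theorem monomialCharacter_apply (L : BraidGroup x₀ →* Multiplicative ℤ) (μ : ParamIndex W →₀ ℤ)
    (b : BraidGroup x₀) :
    monomialCharacter L μ b = AddMonoidAlgebra.single ((L b).toAdd • μ) 1 := rfl

variable [Finite W]

-- The twist multiplies a generator of `C` by `𝐮^{Nμ}`, the same factor that `orbitScale` puts on
-- each `u_{C,j}`, and leaves the generators and indeterminates of the other orbits alone.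
open Classical in
theorem exists_heckeHom_orbitScale (C : Orbits W) (μ : ParamIndex W →₀ ℤ) (N : ℤ)
    (L : BraidGroup x₀ →* Multiplicative ℤ)
    (hL : ∀ C' b, IsMonodromyGenerator x₀ C' b →
      L b = Multiplicative.ofAdd (if C' = C then N else 0)) :
    ∃ Φ : HeckeAlgebra x₀ →+* HeckeAlgebra x₀,
      (∀ r h, Φ (r • h) = orbitScale C N μ r • Φ h) ∧
        ∀ b, Φ (braidImage x₀ b) = monomialCharacter L μ b • braidImage x₀ b := by
  refine exists_heckeHom_twist (RingHom.id _) (orbitScale C N μ) (RingHom.id _)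
    (fun r h => rfl) (monomialCharacter L μ) fun C' b hb j => ?_
  rw [monomialCharacter_apply, hL C' b hb, param, RingHom.id_apply, orbitScale_single,
    AddMonoidAlgebra.single_mul_single, orbitDegree_single, mul_one, add_comm, toAdd_ofAdd]
  simp

theorem orbitScale_comp_eq_id {C : Orbits W} {μ : ParamIndex W →₀ ℤ} (hμ : orbitDegree C μ = 0)
    {N : ℤ} {L L' : BraidGroup x₀ →* Multiplicative ℤ} (hLL' : ∀ b, L b * L' b = 1)
    {Φ Φ' : HeckeAlgebra x₀ →+* HeckeAlgebra x₀}
    (hΦ : ∀ r h, Φ (r • h) = orbitScale C N μ r • Φ h)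
    (hΦb : ∀ b, Φ (braidImage x₀ b) = monomialCharacter L μ b • braidImage x₀ b)
    (hΦ' : ∀ r h, Φ' (r • h) = orbitScale C (-N) μ r • Φ' h)
    (hΦb' : ∀ b, Φ' (braidImage x₀ b) = monomialCharacter L' μ b • braidImage x₀ b)
    (h : HeckeAlgebra x₀) : Φ' (Φ h) = h := by
  induction h using hecke_induction with
  | braid b =>
    rw [hΦb, hΦ', hΦb', smul_smul, monomialCharacter_apply, monomialCharacter_apply,
      orbitScale_single, AddMonoidAlgebra.single_mul_single, map_zsmul, hμ, smul_zero, mul_zero,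
      zero_smul, add_zero, ← add_smul, ← toAdd_mul, hLL', toAdd_one, zero_smul, mul_one,
      ← AddMonoidAlgebra.one_def, one_smul]
  | add x y hx hy => rw [map_add, map_add, hx, hy]
  | smul r x hx => rw [hΦ, hΦ', hx, orbitScale_neg_apply hμ]

end Homogeneity

/-! ### Uniqueness of the canonical form forces homogeneity -/

section CanonicalForm

variable {K : Type*} [Field K] [NumberField K] [Algebra K ℂ]
  {V : Type*} [AddCommGroup V] [Module K V] {W : Subgroup (V ≃ₗ[K] V)} [Finite W]

theorem zeta_pow (C : Orbits W) : zeta (K := K) C ^ ramification C = 1 := by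
  have h0 : ramification C ≠ 0 := (zero_lt_one.trans (one_lt_ramification C)).ne'
  have h : algebraMap K ℂ ((zeta (K := K) C : NumberField.RingOfIntegers K) : K)
      = Complex.exp (2 * Real.pi * Complex.I / ramification C) := (exists_zeta C).choose_spec
  have h1 : algebraMap K ℂ (((zeta (K := K) C ^ ramification C : (NumberField.RingOfIntegers K)ˣ) :
      NumberField.RingOfIntegers K) : K) = algebraMap K ℂ 1 := by
    rw [Units.val_pow_eq_pow_val, map_one]
    change algebraMap K ℂ (algebraMap (NumberField.RingOfIntegers K) K (_ ^ _)) = 1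
    rw [map_pow, map_pow]
    exact (congrArg (· ^ _) h).trans (Complex.isPrimitiveRoot_exp _ h0).pow_eq_one
  have h2 := (algebraMap K ℂ).injective h1
  exact Units.ext (NumberField.RingOfIntegers.ext h2)

variable {x₀ : Regular W}

open Classical in
/-- The canonical form takes homogeneous values: the exponents occurring in `t(b)` have degree
`L(b)/N` with respect to the orbit `C`. -/
theorem canonicalForm_homogeneous {t : HeckeAlgebra x₀ →ₗ[ParamRing W] ParamRing W}
    (ht : IsCanonicalForm x₀ t) (huniq : ∀ t', IsCanonicalForm x₀ t' → t' = t)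
    (C : Orbits W) (N : ℤ) (L : BraidGroup x₀ →* Multiplicative ℤ)
    (hL : ∀ C' b, IsMonodromyGenerator x₀ C' b →
      L b = Multiplicative.ofAdd (if C' = C then N else 0))
    (b : BraidGroup x₀) {a : ParamIndex W →₀ ℤ} (ha : (t (braidImage x₀ b)).coeff a ≠ 0) :
    N * orbitDegree C a = (L b).toAdd := by
  have he := one_lt_ramification C
  let i₀ : ParamIndex W := ⟨C, ⟨0, zero_lt_one.trans he⟩⟩
  let i₁ : ParamIndex W := ⟨C, ⟨1, he⟩⟩
  -- `𝐮^μ = (u_{C,0}/u_{C,1})^e` is a nontrivial monomial of degree 0, so rescaling by it is an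
  -- automorphism of `ℤ[𝐮, 𝐮⁻¹]`. The exponent `e` makes it specialize to 1, which protects the
  -- specialization property of `t`.
  let μ : ParamIndex W →₀ ℤ :=
    Finsupp.single i₀ (ramification C : ℤ) - Finsupp.single i₁ (ramification C : ℤ)
  have hμ : orbitDegree C μ = 0 := by
    rw [map_sub, orbitDegree_single, orbitDegree_single]
    simp [i₀, i₁]
  have hμ0 : μ ≠ 0 := by
    intro h
    have h1 := DFunLike.congr_fun h i₀
    have h2 : i₁ ≠ i₀ := by simp [i₀, i₁]
    simp [μ, Finsupp.single_eq_of_ne h2.symm] at h1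
    omega
  let z : ParamIndex W → (NumberField.RingOfIntegers K)ˣ := fun i => zeta (K := K) i.1 ^ (i.2 : ℕ)
  have hz : specialize z (AddMonoidAlgebra.single μ 1) = 1 := by
    apply specialize_single_sub <;>
    · change (zeta (K := K) C ^ _) ^ ramification C = 1
      rw [← pow_mul, mul_comm, pow_mul, zeta_pow, one_pow]
  obtain ⟨Φ, hΦ, hΦb⟩ := exists_heckeHom_orbitScale C μ N L hL
  obtain ⟨Ψ, hΨ, hΨb⟩ := exists_heckeHom_orbitScale (x₀ := x₀) C μ (-N) L⁻¹
    (fun C' b hb => by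
      rw [MonoidHom.inv_apply, hL C' b hb, ← ofAdd_neg]
      split_ifs <;> simp)
  let Φe : HeckeAlgebra x₀ ≃+* HeckeAlgebra x₀ := RingEquiv.ofRingHom Φ Ψ
    (RingHom.ext fun h => orbitScale_comp_eq_id (N := -N) (L := L⁻¹) (L' := L) hμ (by simp)
      hΨ hΨb (by simpa using hΦ) hΦb h)
    (RingHom.ext fun h => orbitScale_comp_eq_id hμ (by simp) hΦ hΦb hΨ hΨb h)
  let t' : HeckeAlgebra x₀ →ₗ[ParamRing W] ParamRing W :=
    { toFun := fun h => orbitScale C (-N) μ (t (Φ h))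
      map_add' := fun x y => by simp
      map_smul' := fun r x => by
        rw [hΦ, map_smul, smul_eq_mul, map_mul, orbitScale_neg_apply hμ, RingHom.id_apply,
          smul_eq_mul] }
  have ht'b : ∀ b, t' (braidImage x₀ b)
      = monomialCharacter L μ b * orbitScale C (-N) μ (t (braidImage x₀ b)) := by
    intro b
    change orbitScale C (-N) μ (t (Φ (braidImage x₀ b))) = _
    rw [hΦb, map_smul, smul_eq_mul, map_mul, monomialCharacter_apply, orbitScale_single, map_zsmul,
      hμ, smul_zero, mul_zero, zero_smul, add_zero]
  -- The monomial factors disappear in the group algebra; for the twist identity, `*` commutes with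
  -- `orbitScale` and sends the character at `b⁻¹` to the character at `b`.
  have hcan : IsCanonicalForm x₀ t' := by
    refine ⟨ht.symmetrizing.of_semilinear (orbitScaleEquiv hμ N) Φe hΦ fun h => ?_,
      fun b => ?_, fun b => ?_⟩
    · change orbitScale C N μ (orbitScale C (-N) μ (t (Φ h))) = t (Φ h)
      simpa using orbitScale_neg_apply hμ (-N) (t (Φ h))
    · rw [← ht.specializes b, ht'b, map_mul, specialize_orbitScale z hz, monomialCharacter_apply,
        specialize_zsmul z hz, one_mul]
    · have h1 : invertParams (monomialCharacter L μ b⁻¹) = monomialCharacter L μ b := by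
        rw [monomialCharacter_apply, monomialCharacter_apply, invertParams_single, map_inv,
          toAdd_inv, neg_smul, neg_neg]
      rw [ht'b, ht'b, ht'b, map_mul invertParams, h1, invertParams_orbitScale, map_mul,
        ← ht.twist, map_mul]
      ring
  -- By uniqueness `t' = t`; this is that equality evaluated at `b`, a functional equation for
  -- `t(b)`.
  have key : orbitScale C N μ (t (braidImage x₀ b))
      = AddMonoidAlgebra.single ((L b).toAdd • μ) 1 * t (braidImage x₀ b) := by
    have h1 := LinearMap.congr_fun (huniq t' hcan) (braidImage x₀ b)
    have h2 := congrArg (orbitScale C N μ) h1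
    change orbitScale C N μ (orbitScale C (-N) μ (t (Φ (braidImage x₀ b)))) = _ at h2
    have h3 := orbitScale_neg_apply hμ (-N) (t (Φ (braidImage x₀ b)))
    rw [neg_neg] at h3
    rw [h3, hΦb, map_smul] at h2
    exact h2.symm
  by_contra hne
  exact ha (coeff_eq_zero_of_orbitScale_eq hμ hμ0 key hne)

end CanonicalForm

/-! ### Reflections lift to generators of the monodromy -/

section Reflections

variable {K : Type*} [Field K] {V : Type*} [AddCommGroup V] [Module K V]
  {W : Subgroup (V ≃ₗ[K] V)}

/-- A reflecting hyperplane is recovered from any of its reflections as the kernel of `s - 1`. -/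
theorem finite_hyperplanes [Finite W] : Finite (hyperplanes W) := by
  have key : ∀ H : hyperplanes W, ∃ s : W, H.1 = LinearMap.ker ((s.1 : V →ₗ[K] V) - 1) := by
    rintro ⟨H, hH, s, hs, hs1, hsH⟩
    have hle : H ≤ LinearMap.ker ((s : V →ₗ[K] V) - 1) := fun v hv => by simp [hsH v hv]
    refine ⟨⟨s, hs⟩, ((hH.le_iff.1 hle).resolve_left fun h => hs1 ?_).symm⟩
    · refine LinearEquiv.ext fun v => ?_
      have : v ∈ LinearMap.ker ((s : V →ₗ[K] V) - 1) := by rw [h]; trivial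
      simpa [sub_eq_zero] using this
  choose f hf using key
  exact Finite.of_injective f fun H₁ H₂ h => Subtype.ext (by rw [hf H₁, hf H₂, h])

/-- An element of `W_H` has the form `v ↦ v + f(v) u` with `H = ker f`. -/
theorem exists_form_of_mem_fixer {H : Submodule K V} (hH : IsCoatom H) :
    ∃ (f : Module.Dual K V) (v₀ : V), LinearMap.ker f = H ∧ f v₀ = 1 ∧
      ∀ s ∈ fixer W H, (s.1 : V →ₗ[K] V) = LinearMap.transvection f (s.1 v₀ - v₀) := by
  obtain ⟨v, hv⟩ : ∃ v, v ∉ H := by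
    by_contra h
    push Not at h
    exact hH.1 (eq_top_iff.2 fun v _ => h v)
  obtain ⟨f, hfv, hfH⟩ := Submodule.exists_le_ker_of_notMem hv
  have hker : LinearMap.ker f = H :=
    (hH.le_iff.1 hfH).resolve_left fun h => hfv (by
      have : v ∈ LinearMap.ker f := by rw [h]; trivial
      exact this)
  have h1 : f ((f v)⁻¹ • v) = 1 := by rw [map_smul, smul_eq_mul, inv_mul_cancel₀ hfv]
  refine ⟨f, (f v)⁻¹ • v, hker, h1, fun s hs => LinearMap.ext fun x => ?_⟩
  set v₀ := (f v)⁻¹ • v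
  have h2 : x - f x • v₀ ∈ H := by
    rw [← hker, LinearMap.mem_ker, map_sub, map_smul, h1, smul_eq_mul, mul_one, sub_self]
  have h3 := mem_fixer.1 hs _ h2
  rw [map_sub, map_smul] at h3
  change s.1 x = x + f x • (s.1 v₀ - v₀)
  rw [smul_sub, sub_eq_iff_eq_add.1 h3]
  abel

variable [CharZero K] [FiniteDimensional K V] [Finite W]

/-- For `s : v ↦ v + f(v) u` the determinant is `1 + f(u)`; if it is 1 then `u ∈ H`, so `s` acts
trivially on `V/H`, where `W_H` is faithful. -/
theorem eq_one_of_det_eq_one {H : Submodule K V} (hH : IsCoatom H) (s : fixer W H)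
    (hs : LinearMap.det (s.1.1 : V →ₗ[K] V) = 1) : s = 1 := by
  obtain ⟨f, v₀, hker, h1, hf⟩ := exists_form_of_mem_fixer (W := W) hH
  have h2 := hf s.1 s.2
  rw [h2, LinearMap.transvection.det, add_eq_left] at hs
  refine fixer_faithful s fun v => ?_
  have h3 : s.1.1 v = v + f v • (s.1.1 v₀ - v₀) := LinearMap.congr_fun h2 v
  rw [h3, add_sub_cancel_left]
  exact H.smul_mem _ (hker.le hs)

variable [Algebra K ℂ]

/-- The determinant embeds `W_H` in the multiplicative group of `K`, so `W_H` is cyclic and its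
image in `ℂ` consists of all `e`-th roots of unity. The element over `exp(2πi/e)` has order `e`,
hence generates. -/
theorem exists_isDistinguished {H : Submodule K V} (hH : IsCoatom H) :
    ∃ s : W, IsDistinguished s H ∧ fixer W H ≤ Subgroup.zpowers s := by
  let f : fixer W H →* K :=
    { toFun := fun w => LinearMap.det (w.1.1 : V →ₗ[K] V)
      map_one' := LinearMap.det_id
      map_mul' := fun w w' => LinearMap.det_comp _ _ }
  have hf : Function.Injective f :=
    (injective_iff_map_eq_one f).2 fun w hw => eq_one_of_det_eq_one hH w hw
  have hcyc : IsCyclic (fixer W H) := isCyclic_of_injective_ringHom f hf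
  obtain ⟨g, hg⟩ := IsCyclic.exists_ofOrder_eq_natCard (α := fixer W H)
  have he0 : Nat.card (fixer W H) ≠ 0 := Nat.card_pos.ne'
  have : NeZero (Nat.card (fixer W H)) := ⟨he0⟩
  have hprim : IsPrimitiveRoot (f g) (Nat.card (fixer W H)) := by
    rw [← hg, ← orderOf_injective f hf g]
    exact IsPrimitiveRoot.orderOf _
  have hexp := Complex.isPrimitiveRoot_exp _ he0
  obtain ⟨i, -, hi⟩ := (hprim.map_of_injective
    (algebraMap K ℂ).injective).eq_pow_of_pow_eq_one hexp.pow_eq_one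
  have hi' : algebraMap K ℂ (f (g ^ i))
      = Complex.exp (2 * Real.pi * Complex.I / (Nat.card (fixer W H) : ℕ)) := by
    rw [map_pow, map_pow, hi]
  refine ⟨(g ^ i : fixer W H), ⟨(g ^ i).2, hi'⟩, fun r hr => ?_⟩
  have hord : orderOf (g ^ i) = Nat.card (fixer W H) := by
    rw [← orderOf_injective f hf, ← orderOf_injective (algebraMap K ℂ : K →* ℂ)
      (algebraMap K ℂ).injective]
    change orderOf (algebraMap K ℂ (f (g ^ i))) = _
    rw [hi']
    exact hexp.eq_orderOf.symm
  have htop : (⟨r, hr⟩ : fixer W H) ∈ Subgroup.zpowers (g ^ i) := by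
    rw [(Subgroup.card_eq_iff_eq_top _).1 ((Nat.card_zpowers _).trans hord)]
    trivial
  obtain ⟨k, hk⟩ := Subgroup.mem_zpowers_iff.1 htop
  exact Subgroup.mem_zpowers_iff.2 ⟨k, by
    have := congrArg Subtype.val hk
    simpa using this⟩

end Reflections

/-! ### Paths in the regular space and lifts of reflections to the braid group -/

section Lift

variable {K : Type*} [Field K] [Algebra K ℂ] {V : Type*} [AddCommGroup V] [Module K V]
  {W : Subgroup (V ≃ₗ[K] V)}

/-- The inclusion `V → ℂ ⊗ V`. -/
def toComplexified (v : V) : Complexified K V := (1 : ℂ) ⊗ₜ[K] v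

theorem toComplexified_mem {H : Submodule K V} {v : V} (hv : v ∈ H) :
    toComplexified v ∈ complexSubspace H :=
  Submodule.tmul_mem_baseChange_of_mem 1 hv

/-- The class of `v` vanishes in `ℂ ⊗ V/H`, and `V/H` embeds there by faithful flatness. -/
theorem mem_of_toComplexified_mem {H : Submodule K V} {v : V}
    (hv : toComplexified v ∈ complexSubspace H) : v ∈ H := by
  obtain ⟨y, hy⟩ := hv
  have h1 : ∀ y : ℂ ⊗[K] H, LinearMap.baseChange ℂ H.mkQ (LinearMap.baseChange ℂ H.subtype y) = 0 := by
    intro y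
    rw [← LinearMap.comp_apply, ← LinearMap.baseChange_comp]
    have : H.mkQ ∘ₗ H.subtype = 0 := by ext; simp
    rw [this, LinearMap.baseChange_zero, LinearMap.zero_apply]
  have h2 := h1 y
  have h3 : LinearMap.baseChange ℂ H.subtype y = (1 : ℂ) ⊗ₜ[K] v := hy
  rw [h3, LinearMap.baseChange_tmul] at h2
  have h4 := Module.FaithfullyFlat.tensorProduct_mk_injective (A := K) (B := ℂ) (V ⧸ H)
    (h2.trans (TensorProduct.tmul_zero _ _).symm)
  exact (Submodule.Quotient.mk_eq_zero H).1 h4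

theorem complexify_toComplexified (s : V ≃ₗ[K] V) (v : V) :
    complexify s (toComplexified v) = toComplexified (s v) :=
  LinearMap.baseChange_tmul ..

theorem toComplexified_smul (c : K) (v : V) :
    toComplexified (c • v) = algebraMap K ℂ c • (toComplexified v : Complexified K V) := by
  change (1 : ℂ) ⊗ₜ[K] (c • v) = algebraMap K ℂ c • ((1 : ℂ) ⊗ₜ[K] v)
  rw [TensorProduct.tmul_smul, TensorProduct.smul_tmul', TensorProduct.smul_tmul',
    Algebra.smul_def, smul_eq_mul]

/-- A complex line which is not contained in a subspace through the origin meets it in at most one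
point. -/
theorem subsingleton_line_inter {M : Type*} [AddCommGroup M] [Module ℂ M] (U : Submodule ℂ M)
    {x : M} (hx : x ∉ U) (u : M) : {z : ℂ | x + z • u ∈ U}.Subsingleton := by
  intro z hz z' hz'
  by_contra hne
  have hu : u ∈ U := by
    have h1 := U.sub_mem hz hz'
    rw [add_sub_add_left_eq_sub, ← sub_smul] at h1
    exact (U.smul_mem_iff (sub_ne_zero.2 hne)).1 h1
  exact hx ((U.add_mem_iff_left (U.smul_mem z hu)).1 hz)

/-- The path `γ` is itself the lift from `x₀` of its image in the quotient, and it ends at `w • x₀`.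
-/
theorem braidToGroup_braidOfPath {x₀ : Regular W}
    (h : IsQuotientCoveringMap (toQuotient : Regular W → RegularQuotient W) W)
    (w : W) (γ : Path x₀ (w • x₀)) : braidToGroup x₀ (braidOfPath w γ) = w := by
  rw [braidToGroup, dif_pos h]
  change MulOpposite.unop (h.fundamentalGroupToMulOpposite (x := toQuotient x₀) ⟨x₀, rfl⟩ _) = w
  rw [← MulOpposite.op_inj, MulOpposite.op_unop, h.fundamentalGroupToMulOpposite_apply_eq_Iff]
  change w • x₀ = _
  have h1 := h.isCoveringMap.monodromy_eq_of_map_eq (x := toQuotient x₀) (y := toQuotient x₀)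
    (γ := Path.Homotopic.Quotient.mk
    ((γ.map continuous_quotient_mk').cast rfl (toQuotient_smul w x₀).symm))
    (ex := ⟨x₀, rfl⟩) (ey := ⟨w • x₀, toQuotient_smul w x₀⟩)
    (Path.Homotopic.Quotient.mk γ) rfl
  exact (congrArg Subtype.val h1).symm

theorem finite_line_inter [Finite W] (S : Set (Submodule K V)) (hS : S ⊆ hyperplanes W)
    {x : Complexified K V} (hx : ∀ H ∈ S, x ∉ complexSubspace H) (u : Complexified K V) :
    {z : ℂ | ∃ H ∈ S, x + z • u ∈ complexSubspace H}.Finite := by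
  have : {z : ℂ | ∃ H ∈ S, x + z • u ∈ complexSubspace H}
      = ⋃ H ∈ S, {z : ℂ | x + z • u ∈ complexSubspace H} := by ext; simp
  rw [this]
  have hfin : Finite (hyperplanes W) := finite_hyperplanes
  exact Set.Finite.biUnion (Set.Finite.subset (Set.toFinite (hyperplanes W)) hS) fun H hH =>
    (subsingleton_line_inter _ (hx H hH) u).finite

/-- `V^reg` is path connected. -/
theorem joined_regular [Finite W] (x y : Regular W) : Joined x y := by
  -- The complex line through `x` and `y` meets the hyperplanes in finitely many points, and
  -- removing them from `ℂ` leaves a path connected set containing the parameters 0 and 1.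
  have hfin := finite_line_inter (hyperplanes W) subset_rfl x.2 (y.1 - x.1)
  have hpc := hfin.countable.isPathConnected_compl_of_one_lt_rank
    (by rw [Complex.rank_real_complex]; exact Cardinal.one_lt_two)
  obtain ⟨γ, hγ⟩ := hpc.joinedIn 0 (by simpa using x.2) 1 (by simpa using y.2)
  refine ⟨{
    toFun := fun s => ⟨x.1 + γ s • (y.1 - x.1), fun H hH h => hγ s ⟨H, hH, h⟩⟩
    continuous_toFun := Continuous.subtype_mk (by fun_prop) _
    source' := Subtype.ext (by simp)
    target' := Subtype.ext (by simp) }⟩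

variable [CharZero K] [FiniteDimensional K V] [Finite W]

/-- The point is `v + ε u`, with `v ∈ H` on no other reflecting hyperplane, `u` an eigenvector of
`s` off `H`, and `ε > 0` small. Such a `v` exists because a vector space over an infinite field is
not a finite union of proper subspaces. -/
theorem exists_isCloseTo {H : Submodule K V} (hH : H ∈ hyperplanes W) {s : W}
    (hs : IsDistinguished s H) : ∃ x : Regular W, IsCloseTo s H x := by
  have hfin : Finite (hyperplanes W) := finite_hyperplanes
  obtain ⟨v, hvH, hv⟩ : ∃ v ∈ H, ∀ H' ∈ hyperplanes W, H' ≠ H → v ∉ H' := by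
    by_contra hcon
    push Not at hcon
    have hfin' : Finite {H' // H' ∈ hyperplanes W ∧ H' ≠ H} :=
      Finite.of_injective (fun H' => (⟨H'.1, H'.2.1⟩ : hyperplanes W)) fun a b h =>
        Subtype.ext (Subtype.mk.inj h)
    obtain ⟨⟨H', hH', hne⟩, htop⟩ := Subspace.exists_eq_top_of_iUnion_eq_univ
      (ι := {H' // H' ∈ hyperplanes W ∧ H' ≠ H}) (p := fun H' => H'.1.comap H.subtype) (by
        refine Set.eq_univ_of_forall fun v => ?_
        obtain ⟨H', h1, h2, h3⟩ := hcon v.1 v.2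
        exact Set.mem_iUnion.2 ⟨⟨H', h1, h2⟩, h3⟩)
    have hle : H ≤ H' := Submodule.comap_subtype_eq_top.1 htop
    exact hne ((hH.1.le_iff.1 hle).resolve_left hH'.1.1)
  obtain ⟨f, v₀, hker, h1, hf⟩ := exists_form_of_mem_fixer (W := W) hH.1
  set u := s.1 v₀ - v₀ with hu
  set ζ := Complex.exp (2 * Real.pi * Complex.I / (Nat.card (fixer W H) : ℕ)) with hζ
  have hζ1 : ζ ≠ 1 := exp_card_ne_one hH
  have hsx : ∀ x, s.1 x = x + f x • u := fun x => LinearMap.congr_fun (hf s hs.1) x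
  have hdet : algebraMap K ℂ (1 + f u) = ζ := by
    have h2 := hs.2
    rwa [hf s hs.1, LinearMap.transvection.det] at h2
  have huH : u ∉ H := by
    rw [← hker, LinearMap.mem_ker]
    intro h
    rw [h, add_zero, map_one] at hdet
    exact hζ1 hdet.symm
  set p : Complexified K V := toComplexified v
  set q : Complexified K V := toComplexified u
  have hsp : complexify s.1 p = p := by
    rw [complexify_toComplexified, mem_fixer.1 hs.1 v hvH]
  have hsq : complexify s.1 q = ζ • q := by
    rw [complexify_toComplexified, hsx, ← hdet, ← toComplexified_smul, add_smul, one_smul]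
  have hp : ∀ H' ∈ hyperplanes W \ {H}, p ∉ complexSubspace H' := fun H' hH' h =>
    hv H' hH'.1 hH'.2 (mem_of_toComplexified_mem h)
  -- The other hyperplanes meet the line `p + ℂ q` in finitely many points, none of them `p`; the
  -- radius `ε` avoids them all.
  have hbad := finite_line_inter (hyperplanes W \ {H}) Set.sdiff_subset hp q
  obtain ⟨ε, hε, hball⟩ : ∃ ε > 0, ∀ z : ℂ, ‖z‖ ≤ ε →
      ∀ H' ∈ hyperplanes W, H' ≠ H → p + z • q ∉ complexSubspace H' := by
    have h0 : (0 : ℂ) ∉ {z : ℂ | ∃ H' ∈ hyperplanes W \ {H}, p + z • q ∈ complexSubspace H'} := by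
      rintro ⟨H', hH', h⟩
      exact hp H' hH' (by simpa using h)
    obtain ⟨ε, hε, hsub⟩ := Metric.nhds_basis_closedBall.mem_iff.1
      (hbad.isClosed.isOpen_compl.mem_nhds h0)
    exact ⟨ε, hε, fun z hz H' hH' hne h => hsub (by simpa using hz) ⟨H', ⟨hH', hne⟩, h⟩⟩
  have havoid : ∀ z : ℂ, z ≠ 0 → ‖z‖ ≤ 1 → ∀ H' ∈ hyperplanes W,
      p + (z * ε) • q ∉ complexSubspace H' := by
    intro z hz0 hz H' hH' h
    by_cases hne : H' = H
    · rw [hne, (complexSubspace H).add_mem_iff_right (toComplexified_mem hvH),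
        (complexSubspace H).smul_mem_iff (mul_ne_zero hz0 (by exact_mod_cast hε.ne'))] at h
      exact huH (mem_of_toComplexified_mem h)
    · refine hball (z * ε) ?_ H' hH' hne h
      rw [norm_mul, Complex.norm_real, Real.norm_of_nonneg hε.le]
      exact mul_le_of_le_one_left hε.le hz
  -- Here `p` is the component fixed by `s` and `ε q` the component multiplied by `ζ`.
  have hrot : ∀ z, rotate s (Nat.card (fixer W H)) (p + (ε : ℂ) • q) z = p + (z * ε) • q := by
    intro z
    rw [rotate, map_add, map_smul, hsp, hsq, ← hζ]
    have h2 : p + (ε : ℂ) • ζ • q - (p + (ε : ℂ) • q) = ((ζ - 1) * ε) • q := by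
      rw [sub_mul, sub_smul, one_mul, smul_smul, mul_comm ζ]
      abel
    rw [h2, smul_smul, ← mul_assoc, div_mul_cancel₀ _ (sub_ne_zero.2 hζ1), sub_mul, sub_smul,
      one_mul]
    abel
  refine ⟨⟨p + (ε : ℂ) • q, fun H' hH' => ?_⟩, fun z hz0 hz H' hH' => ?_, fun H' hH' hne => ?_⟩
  · simpa using havoid 1 one_ne_zero (by simp) H' hH'
  · rw [hrot]
    exact havoid z hz0 hz H' hH'
  · rw [hrot, zero_mul, zero_smul, add_zero]
    exact hp H' ⟨hH', hne⟩

/-- Every pseudo-reflection is a power of the distinguished reflection of its hyperplane, and that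
one lifts to a monodromy generator along any path from `x₀` to a point close to the hyperplane. -/
theorem mem_closure_monodromy (x₀ : Regular W) (hW : IsGeneratedByReflections W)
    (h : IsQuotientCoveringMap (toQuotient : Regular W → RegularQuotient W) W) (w : W) :
    w ∈ Subgroup.closure
      {s : W | ∃ C b, IsMonodromyGenerator x₀ C b ∧ braidToGroup x₀ b = s} := by
  set G := Subgroup.closure
    {s : W | ∃ C b, IsMonodromyGenerator x₀ C b ∧ braidToGroup x₀ b = s}
  have hw : w.1 ∈ Subgroup.closure {s | s ∈ W ∧ IsPseudoReflection s} := by rw [hW]; exact w.2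
  suffices ∃ hx : w.1 ∈ W, (⟨w.1, hx⟩ : W) ∈ G from this.2
  refine Subgroup.closure_induction (p := fun x _ => ∃ hx : x ∈ W, (⟨x, hx⟩ : W) ∈ G)
    ?_ ⟨W.one_mem, G.one_mem⟩ ?_ ?_ hw
  · rintro r ⟨hr, hr1, H, hH, hrH⟩
    obtain ⟨s, hs, hle⟩ := exists_isDistinguished (W := W) hH
    have hHW : H ∈ hyperplanes W := ⟨hH, r, hr, hr1, hrH⟩
    obtain ⟨x, hx⟩ := exists_isCloseTo hHW hs
    obtain ⟨γ⟩ := joined_regular x₀ x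
    have hsG : s ∈ G := Subgroup.subset_closure
      ⟨_, _, ⟨⟨H, hHW⟩, s, x, γ, hx, rfl, hs, rfl⟩, braidToGroup_braidOfPath h s _⟩
    exact ⟨hr, (Subgroup.zpowers_le.2 hsG) (hle (mem_fixer.2 hrH))⟩
  · rintro x y - - ⟨hx, hx'⟩ ⟨hy, hy'⟩
    exact ⟨W.mul_mem hx hy, G.mul_mem hx' hy'⟩
  · rintro x - ⟨hx, hx'⟩
    exact ⟨W.inv_mem hx, G.inv_mem hx'⟩

end Lift

/-! ### Divisibility of the degree character -/

section Divisibility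

variable {K : Type*} [Field K] [NumberField K] [Algebra K ℂ]
  {V : Type*} [AddCommGroup V] [Module K V] [FiniteDimensional K V]
  {W : Subgroup (V ≃ₗ[K] V)} [Finite W] {x₀ : Regular W}

-- If `b` maps to 1 in `W`, then `t(b)` specializes to 1, so it contains some monomial `a`, and
-- `L(b) = N deg a`. Any other `b` differs from such an element by a product of monodromy generators
-- and their inverses, on which `L` is a multiple of `N`. This avoids knowing that these generators
-- generate `B`.
open Classical in
theorem dvd_degree (hW : IsGeneratedByReflections W)
    {t : HeckeAlgebra x₀ →ₗ[ParamRing W] ParamRing W}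
    (ht : IsCanonicalForm x₀ t) (huniq : ∀ t', IsCanonicalForm x₀ t' → t' = t)
    (C : Orbits W) (N : ℤ) (L : BraidGroup x₀ →* Multiplicative ℤ)
    (hL : ∀ C' b, IsMonodromyGenerator x₀ C' b →
      L b = Multiplicative.ofAdd (if C' = C then N else 0))
    (b : BraidGroup x₀) : N ∣ (L b).toAdd := by
  have hker : ∀ b, braidToGroup x₀ b = 1 → N ∣ (L b).toAdd := by
    intro b hb
    have h1 := ht.specializes b
    rw [if_pos hb] at h1
    have h2 : t (braidImage x₀ b) ≠ 0 := by
      intro h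
      rw [h, map_zero] at h1
      exact zero_ne_one h1
    obtain ⟨a, ha⟩ : ∃ a, (t (braidImage x₀ b)).coeff a ≠ 0 := by
      by_contra hcon
      push Not at hcon
      exact h2 (AddMonoidAlgebra.coeff_injective (Finsupp.ext hcon))
    exact ⟨_, (canonicalForm_homogeneous ht huniq C N L hL b ha).symm⟩
  by_cases h : IsQuotientCoveringMap (toQuotient : Regular W → RegularQuotient W) W
  · let B₁ : Subgroup (BraidGroup x₀) := (Subgroup.zpowers (Multiplicative.ofAdd N)).comap L
    have hB₁ : ∀ b, b ∈ B₁ ↔ N ∣ (L b).toAdd := fun b => by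
      rw [Subgroup.mem_comap, ← Int.mem_zmultiples_iff]
      rfl
    have hle : Subgroup.closure
        {s : W | ∃ C b, IsMonodromyGenerator x₀ C b ∧ braidToGroup x₀ b = s}
        ≤ B₁.map (braidToGroup x₀) := by
      rw [Subgroup.closure_le]
      rintro _ ⟨C', b, hb, rfl⟩
      refine ⟨b, (hB₁ b).2 ?_, rfl⟩
      rw [hL C' b hb, toAdd_ofAdd]
      split_ifs <;> simp
    obtain ⟨b', hb', hbb'⟩ := hle (mem_closure_monodromy x₀ hW h (braidToGroup x₀ b))
    have h1 : b * b'⁻¹ ∈ B₁ := (hB₁ _).2 (hker _ (by rw [map_mul, map_inv, hbb', mul_inv_cancel]))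
    rw [← hB₁]
    simpa using B₁.mul_mem h1 hb'
  -- Without the covering property `braidToGroup` takes its default value, the trivial map, and
  -- every braid is in the kernel.
  · exact hker b (by rw [braidToGroup, dif_neg h, MonoidHom.one_apply])

end Divisibility

/-! ### Simple modules and irreducible characters -/

section Characters

/-- Two simple modules `M` and `M'` are isomorphic as soon as every element of the ring which kills
some fixed finite family of elements of `M'` annihilates `M`. -/
theorem nonempty_linearEquiv_of_annihilator_le {A M M' ι : Type*} [Ring A] [AddCommGroup M]
    [Module A M] [AddCommGroup M'] [Module A M'] [IsSimpleModule A M] [IsSimpleModule A M']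
    [Finite ι] (v : ι → M') (h : ∀ a : A, (∀ i, a • v i = 0) → ∀ m : M, a • m = 0) :
    Nonempty (M ≃ₗ[A] M') := by
  have := IsSimpleModule.nontrivial A M
  obtain ⟨m, hm⟩ := exists_ne (0 : M)
  -- The quotient of `A` by the annihilator of the family embeds in a finite power of `M'`, hence is
  -- semisimple. It maps onto `M`, so `M` splits off, and some coordinate of the embedding gives a
  -- nonzero map from `M` to `M'`.
  let f : A →ₗ[A] ι → M' := LinearMap.toSpanSingleton A _ v
  let g : A →ₗ[A] M := LinearMap.toSpanSingleton A _ m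
  have hker : LinearMap.ker f ≤ LinearMap.ker g := fun a ha => h a (fun i => congrFun ha i) m
  let e := f.quotKerEquivRange
  let g' : (A ⧸ LinearMap.ker f) →ₗ[A] M := (LinearMap.ker f).liftQ g hker
  have hg' : Function.Surjective g' := by
    rw [← LinearMap.range_eq_top, Submodule.range_liftQ]
    refine (eq_bot_or_eq_top _).resolve_left fun hbot => hm ?_
    have : g 1 ∈ LinearMap.range g := ⟨1, rfl⟩
    rw [hbot, Submodule.mem_bot] at this
    simpa [g] using this
  have : IsSemisimpleModule A (A ⧸ LinearMap.ker f) := IsSemisimpleModule.congr e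
  obtain ⟨s, hs⟩ := IsSemisimpleModule.lifting_property g' hg' LinearMap.id
  have hs0 : s m ≠ 0 := fun h0 => hm (by
    have := LinearMap.congr_fun hs m
    simpa [h0] using this.symm)
  have h1 : ((e (s m) : ι → M')) ≠ 0 := fun h0 => hs0 (e.map_eq_zero_iff.1 (Subtype.ext h0))
  obtain ⟨i, hi⟩ := Function.ne_iff.1 h1
  let k : M →ₗ[A] M' :=
    (LinearMap.proj i).comp ((LinearMap.range f).subtype.comp (e.toLinearMap.comp s))
  rcases LinearMap.bijective_or_eq_zero k with hk | hk
  · exact ⟨LinearEquiv.ofBijective k hk⟩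
  · exact absurd (LinearMap.congr_fun hk m) hi

variable {F A : Type*} [Field F] [Ring A] [Algebra F A]

/-- The character of an irreducible representation is determined by its kernel. -/
theorem trace_eq_of_ker_le {d d' : ℕ} (ρ : A →ₐ[F] Module.End F (Fin d → F))
    (ρ' : A →ₐ[F] Module.End F (Fin d' → F)) (hd : 0 < d) (hd' : 0 < d')
    (hρ : ∀ U : Submodule F (Fin d → F), (∀ a, ∀ v ∈ U, ρ a v ∈ U) → U = ⊥ ∨ U = ⊤)
    (hρ' : ∀ U : Submodule F (Fin d' → F), (∀ a, ∀ v ∈ U, ρ' a v ∈ U) → U = ⊥ ∨ U = ⊤)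
    (hker : ∀ a, ρ' a = 0 → ρ a = 0) (a : A) :
    LinearMap.trace F _ (ρ a) = LinearMap.trace F _ (ρ' a) := by
  let i₁ : Module A (Fin d → F) := Module.compHom _ ρ.toRingHom
  let i₂ : Module A (Fin d' → F) := Module.compHom _ ρ'.toRingHom
  have : Nonempty (Fin d) := ⟨⟨0, hd⟩⟩
  have : Nonempty (Fin d') := ⟨⟨0, hd'⟩⟩
  have s₁ : IsScalarTower F A (Fin d → F) := ⟨fun c a v =>
    LinearMap.congr_fun (map_smul ρ c a) v⟩
  have s₂ : IsScalarTower F A (Fin d' → F) := ⟨fun c a v =>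
    LinearMap.congr_fun (map_smul ρ' c a) v⟩
  have key : ∀ {M : Type _} [AddCommGroup M] [Module F M] [Module A M] [IsScalarTower F A M]
      [Nontrivial M], (∀ U : Submodule F M, (∀ a : A, ∀ v ∈ U, a • v ∈ U) → U = ⊥ ∨ U = ⊤) →
      IsSimpleModule A M := by
    intro M _ _ _ _ _ hM
    refine { eq_bot_or_eq_top := fun U => ?_ }
    have h1 := hM (U.restrictScalars F) fun a v hv => U.smul_mem a hv
    simpa using h1
  have m₁ : IsSimpleModule A (Fin d → F) := key hρ
  have m₂ : IsSimpleModule A (Fin d' → F) := key hρ'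
  obtain ⟨e⟩ := nonempty_linearEquiv_of_annihilator_le (A := A) (M := Fin d → F)
    (M' := Fin d' → F) (Pi.basisFun F (Fin d')) fun a ha m => by
      have h0 : ρ' a = 0 := (Pi.basisFun F (Fin d')).ext fun i => ha i
      exact LinearMap.congr_fun (hker a h0) m
  rw [← LinearMap.trace_conj' (ρ a) (e.restrictScalars F)]
  congr 1
  refine LinearMap.ext fun v => ?_
  have h1 := e.map_smul a (e.symm v)
  rw [e.apply_symm_apply] at h1
  exact h1

theorem IsIrreducibleCharacter.mul_comm {χ : A →ₗ[F] F} (hχ : IsIrreducibleCharacter F A χ)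
    (a b : A) : χ (a * b) = χ (b * a) := by
  obtain ⟨d, ρ, -, -, rfl⟩ := hχ
  simp only [LinearMap.comp_apply, AlgHom.toLinearMap_apply, map_mul]
  exact LinearMap.trace_mul_comm _ _ _

theorem IsIrreducibleCharacter.apply_one_ne_zero [CharZero F] {χ : A →ₗ[F] F}
    (hχ : IsIrreducibleCharacter F A χ) : χ 1 ≠ 0 := by
  obtain ⟨d, ρ, hd, -, rfl⟩ := hχ
  simp only [LinearMap.comp_apply, AlgHom.toLinearMap_apply, map_one, LinearMap.trace_one,
    Module.finrank_fin_fun]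
  exact_mod_cast hd.ne'

theorem IsIrreducibleCharacter.comp {A' : Type*} [Ring A'] [Algebra F A'] {χ : A →ₗ[F] F}
    (hχ : IsIrreducibleCharacter F A χ) (Ψ : A' ≃ₐ[F] A) :
    IsIrreducibleCharacter F A' (χ ∘ₗ Ψ.toLinearMap) := by
  obtain ⟨d, ρ, hd, hρ, rfl⟩ := hχ
  refine ⟨d, ρ.comp Ψ, hd, fun U hU => hρ U fun a v hv => ?_, rfl⟩
  have h1 := hU (Ψ.symm a) v hv
  simpa using h1

/-- `τ` is a trace form with non-degenerate associated bilinear form. -/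
structure IsNondegenerateTrace (τ : A →ₗ[F] F) : Prop where
  mul_comm : ∀ a b, τ (a * b) = τ (b * a)
  eq_zero : ∀ a, (∀ b, τ (a * b) = 0) → a = 0

/-- As `τ` and `χ` are both trace forms, `τ((za - az)b) = c(χ(ab) - χ(ba)) = 0`. -/
theorem IsNondegenerateTrace.central {τ χ : A →ₗ[F] F} (hτ : IsNondegenerateTrace τ)
    (hχ : IsIrreducibleCharacter F A χ) {z : A} {c : F} (hz : ∀ a, τ (z * a) = c * χ a) (a : A) :
    z * a = a * z := by
  refine sub_eq_zero.1 (hτ.eq_zero _ fun b => ?_)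
  rw [sub_mul, map_sub, mul_assoc, mul_assoc, hτ.mul_comm a, mul_assoc, hz, hz, hχ.mul_comm,
    sub_self]

/-- From `ρ'(p) = 0` follows `z'p = 0`. Since `z'` is central, the kernel of `ρ(z')` is a
subrepresentation; it contains the nonzero image of `ρ(p)`, so `ρ(z') = 0` by irreducibility, and
`χ` vanishes on `z'A`. -/
theorem IsNondegenerateTrace.mul_eq_zero_of_ker {τ χ χ' : A →ₗ[F] F}
    (hτ : IsNondegenerateTrace τ) {d d' : ℕ} (ρ : A →ₐ[F] Module.End F (Fin d → F))
    (ρ' : A →ₐ[F] Module.End F (Fin d' → F))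
    (hρ : ∀ U : Submodule F (Fin d → F), (∀ a, ∀ v ∈ U, ρ a v ∈ U) → U = ⊥ ∨ U = ⊤)
    (hχ : χ = LinearMap.trace F (Fin d → F) ∘ₗ ρ.toLinearMap)
    (hχ' : χ' = LinearMap.trace F (Fin d' → F) ∘ₗ ρ'.toLinearMap)
    {z z' : A} {c c' : F} (hz : ∀ a, τ (z * a) = c * χ a) (hz' : ∀ a, τ (z' * a) = c' * χ' a)
    (hcen : ∀ a, z' * a = a * z') {p : A} (hp' : ρ' p = 0) (hp : ρ p ≠ 0) : z * z' = 0 := by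
  have hzp : z' * p = 0 := hτ.eq_zero _ fun b => by
    rw [mul_assoc, hz', hχ']
    simp [hp']
  have hρz : ρ z' = 0 := by
    rcases hρ (LinearMap.ker (ρ z')) fun a v hv => by
      rw [LinearMap.mem_ker, ← Module.End.mul_apply, ← map_mul, hcen, map_mul,
        Module.End.mul_apply, LinearMap.mem_ker.1 hv, map_zero] with h | h
    · refine absurd (LinearMap.ext fun v => ?_) hp
      have h1 : ρ p v ∈ LinearMap.ker (ρ z') := by
        rw [LinearMap.mem_ker, ← Module.End.mul_apply, ← map_mul, hzp, map_zero,
          LinearMap.zero_apply]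
      rwa [h, Submodule.mem_bot] at h1
    · exact LinearMap.ker_eq_top.1 h
  refine hτ.eq_zero _ fun b => ?_
  rw [mul_assoc, hz, hχ]
  simp [hρz]

/-- Elements representing distinct irreducible characters are orthogonal. -/
theorem IsNondegenerateTrace.mul_eq_zero {τ : A →ₗ[F] F} (hτ : IsNondegenerateTrace τ)
    {χ χ' : Irr F A} (hne : χ ≠ χ') {z z' : A} {c c' : F} (hz : ∀ a, τ (z * a) = c * χ.1 a)
    (hz' : ∀ a, τ (z' * a) = c' * χ'.1 a) : z * z' = 0 := by
  have hcen := hτ.central χ.2 hz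
  have hcen' := hτ.central χ'.2 hz'
  obtain ⟨χ, d, ρ, hd, hρ, hχ⟩ := χ
  obtain ⟨χ', d', ρ', hd', hρ', hχ'⟩ := χ'
  by_cases h : ∀ p, ρ' p = 0 → ρ p = 0
  · refine absurd (Subtype.ext (LinearMap.ext fun a => ?_)) hne
    simp only [hχ, hχ', LinearMap.comp_apply, AlgHom.toLinearMap_apply]
    exact trace_eq_of_ker_le ρ ρ' hd hd' hρ hρ' h a
  · push Not at h
    obtain ⟨p, hp', hp⟩ := h
    exact hτ.mul_eq_zero_of_ker ρ ρ' hρ hχ hχ' hz hz' hcen' hp' hp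

end Characters

/-! ### The trace of the regular representation -/

section RegularTrace

/-- The trace of the left regular representation. -/
def regTrace (R A : Type*) [CommRing R] [Ring A] [Algebra R A] : A →ₗ[R] R :=
  LinearMap.trace R A ∘ₗ (Algebra.lmul R A).toLinearMap

theorem regTrace_apply {R A : Type*} [CommRing R] [Ring A] [Algebra R A] (a : A) :
    regTrace R A a = LinearMap.trace R A (Algebra.lmul R A a) := rfl

theorem regTrace_mul_comm {R A : Type*} [CommRing R] [Ring A] [Algebra R A] (a b : A) :
    regTrace R A (a * b) = regTrace R A (b * a) := by
  rw [regTrace_apply, regTrace_apply, map_mul (Algebra.lmul R A), map_mul (Algebra.lmul R A)]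
  exact LinearMap.trace_mul_comm _ _ _

theorem regTrace_eq_zero_of_mul_self {F A : Type*} [Field F] [Ring A] [Algebra F A] {z : A}
    (hz : z * z = 0) : regTrace F A z = 0 := by
  have h1 : IsNilpotent (Algebra.lmul F A z) := ⟨2, by rw [sq, ← map_mul, hz, map_zero]⟩
  exact (LinearMap.isNilpotent_trace_of_isNilpotent h1).eq_zero

variable {F A : Type*} [Field F] [Ring A] [Algebra F A] [Module.Finite F A]

theorem IsNondegenerateTrace.exists_representing {τ : A →ₗ[F] F} (hτ : IsNondegenerateTrace τ)
    (χ : A →ₗ[F] F) : ∃ z, ∀ a, τ (z * a) = χ a := by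
  let f : A →ₗ[F] Module.Dual F A := LinearMap.compr₂ (LinearMap.mul F A) τ
  have hf : Function.Injective f := (injective_iff_map_eq_zero f).2 fun a ha =>
    hτ.eq_zero a fun b => LinearMap.congr_fun ha b
  obtain ⟨z, hz⟩ := (LinearMap.injective_iff_surjective_of_finrank_eq_finrank
    (Subspace.dual_finrank_eq (K := F) (V := A)).symm).1 hf χ
  exact ⟨z, fun a => LinearMap.congr_fun hz a⟩

/-- Let `z_χ` represent `χ`. These elements are orthogonal, so multiplying a relation by `z_ψ`
leaves `c_ψ z_ψ² = 0`. If `z_ψ² = 0`, then the regular trace of the nilpotent `z_ψ`, namely `ψ(1)`,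
would vanish; here it matters that the form is the regular trace. -/
theorem linearIndependent_irr [CharZero F] (hτ : IsNondegenerateTrace (regTrace F A)) :
    LinearIndependent F (fun χ : Irr F A => χ.1) := by
  choose z hz using fun χ : Irr F A => hτ.exists_representing χ.1
  rw [linearIndependent_iff']
  intro s c hc ψ hψ
  have h1 : ∑ χ ∈ s, c χ • z χ = 0 := hτ.eq_zero _ fun b => by
    rw [Finset.sum_mul, map_sum]
    simp only [smul_mul_assoc, map_smul, hz]
    simpa using LinearMap.congr_fun hc b
  have h2 := congrArg (· * z ψ) h1
  simp only [Finset.sum_mul, zero_mul, smul_mul_assoc] at h2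
  rw [Finset.sum_eq_single_of_mem ψ hψ fun χ _ hne => by
    rw [hτ.mul_eq_zero hne (c := 1) (c' := 1) (by simpa using hz χ) (by simpa using hz ψ),
      smul_zero]] at h2
  refine (smul_eq_zero.1 h2).resolve_right fun h3 => ψ.2.apply_one_ne_zero ?_
  rw [← hz, mul_one, regTrace_eq_zero_of_mul_self h3]

theorem finite_irr [CharZero F] (hτ : IsNondegenerateTrace (regTrace F A)) : Finite (Irr F A) :=
  (linearIndependent_irr hτ).finite

theorem _root_.LinearIndependent.eq_of_finsum_inv_smul_eq {F ι M : Type*} [Field F]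
    [AddCommGroup M] [Module F M] [Finite ι] {v : ι → M} (hv : LinearIndependent F v)
    {s s' : ι → F} (h : ∑ᶠ i, (s i)⁻¹ • v i = ∑ᶠ i, (s' i)⁻¹ • v i) : s = s' := by
  have := Fintype.ofFinite ι
  rw [finsum_eq_sum_of_fintype, finsum_eq_sum_of_fintype] at h
  funext i
  have h2 : ∑ i, ((s i)⁻¹ - (s' i)⁻¹) • v i = 0 := by
    simp only [sub_smul, Finset.sum_sub_distrib, h, sub_self]
  exact inv_inj.1 (sub_eq_zero.1 (Fintype.linearIndependent_iff.1 hv _ h2 i))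

theorem IsSchurFamily.unique [CharZero F] (hτ : IsNondegenerateTrace (regTrace F A))
    {t : A →ₗ[F] F} {s s' : Irr F A → F} (hs : IsSchurFamily t s) (hs' : IsSchurFamily t s') :
    s = s' := by
  have hfin := finite_irr hτ
  exact (linearIndependent_irr hτ).eq_of_finsum_inv_smul_eq (hs.2.symm.trans hs'.2)

/-- Transport of Schur elements through an isomorphism. -/
theorem schurElement_comp [CharZero F] {A' : Type*} [Ring A'] [Algebra F A']
    [Module.Finite F A'] (hτ : IsNondegenerateTrace (regTrace F A))
    (hτ' : IsNondegenerateTrace (regTrace F A')) (Ψ : A' ≃ₐ[F] A) (t : A →ₗ[F] F)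
    (χ : Irr F A) :
    schurElement (t ∘ₗ Ψ.toLinearMap) ⟨χ.1 ∘ₗ Ψ.toLinearMap, χ.2.comp Ψ⟩ = schurElement t χ := by
  have hfin := finite_irr hτ
  have hfin' := finite_irr hτ'
  let e : Irr F A ≃ Irr F A' :=
    { toFun := fun χ => ⟨χ.1 ∘ₗ Ψ.toLinearMap, χ.2.comp Ψ⟩
      invFun := fun χ => ⟨χ.1 ∘ₗ Ψ.symm.toLinearMap, χ.2.comp Ψ.symm⟩
      left_inv := fun χ => Subtype.ext (LinearMap.ext fun a => by simp)
      right_inv := fun χ => Subtype.ext (LinearMap.ext fun a => by simp) }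
  have key : ∀ s : Irr F A' → F, IsSchurFamily (t ∘ₗ Ψ.toLinearMap) s ↔
      IsSchurFamily t (fun χ => s (e χ)) := by
    intro s
    refine and_congr ⟨fun h χ => h _, fun h χ => by simpa using h (e.symm χ)⟩ ?_
    have := Fintype.ofFinite (Irr F A)
    have h1 : ∑ᶠ χ : Irr F A', (s χ)⁻¹ • χ.1
        = (∑ᶠ χ : Irr F A, (s (e χ))⁻¹ • χ.1) ∘ₗ Ψ.toLinearMap := by
      rw [← finsum_comp_equiv e, finsum_eq_sum_of_fintype, finsum_eq_sum_of_fintype]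
      ext a
      simp only [LinearMap.comp_apply, LinearMap.sum_apply]
      rfl
    rw [h1]
    refine ⟨fun h => LinearMap.ext fun a => ?_, fun h => by rw [← h]⟩
    simpa using LinearMap.congr_fun h (Ψ.symm a)
  change schurElement (t ∘ₗ Ψ.toLinearMap) (e χ) = _
  by_cases h : ∃ s, IsSchurFamily t s
  · have h' : ∃ s, IsSchurFamily (t ∘ₗ Ψ.toLinearMap) s := by
      obtain ⟨s, hs⟩ := h
      exact ⟨fun χ => s (e.symm χ), (key _).2 (by simpa using hs)⟩
    rw [schurElement, schurElement, dif_pos h, dif_pos h']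
    exact congrFun (((key _).1 h'.choose_spec).unique hτ h.choose_spec) χ
  · have h' : ¬ ∃ s, IsSchurFamily (t ∘ₗ Ψ.toLinearMap) s := fun ⟨s, hs⟩ => h ⟨_, (key s).1 hs⟩
    rw [schurElement, schurElement, dif_neg h, dif_neg h']

end RegularTrace

/-! ### Extension of scalars in terms of bases -/

section Extension

/-- `A'` is obtained from the `R`-algebra `A`, free with basis `β`, by extension of scalars along
`φ : R → S`; the basis `β` becomes the basis `β'`. -/
structure IsScalarExtension {R S A A' ι : Type*} [CommRing R] [CommRing S] [Ring A] [Ring A']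
    [Algebra R A] [Algebra S A'] (φ : R →+* S) (j : A →+* A') (β : Module.Basis ι R A)
    (β' : Module.Basis ι S A') : Prop where
  map_smul : ∀ r a, j (r • a) = φ r • j a
  map_basis : ∀ i, β' i = j (β i)

theorem isScalarExtension_includeRight {R A ι : Type*} (S : Type*) [CommRing R] [CommRing S]
    [Ring A] [Algebra R A] [Algebra R S] (β : Module.Basis ι R A) :
    IsScalarExtension (algebraMap R S)
      (Algebra.TensorProduct.includeRight : A →ₐ[R] S ⊗[R] A).toRingHom β (β.baseChange S) where
  map_smul r a := by
    change (Algebra.TensorProduct.includeRight : A →ₐ[R] S ⊗[R] A) (r • a) = _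
    rw [_root_.map_smul, algebraMap_smul]
    rfl
  map_basis i := Module.Basis.baseChange_apply S β i

theorem IsScalarExtension.comp {R S T A A' A'' ι : Type*} [CommRing R] [CommRing S] [CommRing T]
    [Ring A] [Ring A'] [Ring A''] [Algebra R A] [Algebra S A'] [Algebra T A''] {φ : R →+* S}
    {ψ : S →+* T} {j : A →+* A'} {k : A' →+* A''} {β : Module.Basis ι R A}
    {β' : Module.Basis ι S A'} {β'' : Module.Basis ι T A''} (h' : IsScalarExtension ψ k β' β'')
    (h : IsScalarExtension φ j β β') : IsScalarExtension (ψ.comp φ) (k.comp j) β β'' where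
  map_smul r a := by simp [h.map_smul, h'.map_smul]
  map_basis i := by rw [h'.map_basis, h.map_basis, RingHom.comp_apply]

variable {R S A A' ι : Type*} [CommRing R] [CommRing S] [Ring A] [Ring A']
    [Algebra R A] [Algebra S A'] {φ : R →+* S} {j : A →+* A'} {β : Module.Basis ι R A}
    {β' : Module.Basis ι S A'}

theorem IsScalarExtension.linearMap_ext (h : IsScalarExtension φ j β β') {M : Type*}
    [AddCommGroup M] [Module S M] {f g : A' →ₗ[S] M} (hfg : ∀ a, f (j a) = g (j a)) : f = g :=
  β'.ext fun i => by rw [h.map_basis, hfg]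

variable [Fintype ι]

namespace IsScalarExtension

theorem map_eq_sum (h : IsScalarExtension φ j β β') (a : A) :
    j a = ∑ i, φ (β.repr a i) • β' i := by
  conv_lhs => rw [← β.sum_repr a]
  simp only [map_sum, h.map_smul, h.map_basis]

theorem repr_map (h : IsScalarExtension φ j β β') (a : A) (i : ι) :
    β'.repr (j a) i = φ (β.repr a i) := by
  rw [h.map_eq_sum, β'.repr_sum_self]

theorem regTrace_map (h : IsScalarExtension φ j β β') (a : A) :
    regTrace S A' (j a) = φ (regTrace R A a) := by
  classical
  rw [regTrace_apply, regTrace_apply, LinearMap.trace_eq_matrix_trace S β',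
    LinearMap.trace_eq_matrix_trace R β, Matrix.trace, Matrix.trace, map_sum]
  refine Finset.sum_congr rfl fun i _ => ?_
  rw [Matrix.diag_apply, Matrix.diag_apply, LinearMap.toMatrix_apply, LinearMap.toMatrix_apply,
    h.map_basis]
  change β'.repr (j a * j (β i)) i = φ (β.repr (a * β i) i)
  rw [← map_mul, h.repr_map]

theorem exists_lift (h : IsScalarExtension φ j β β') {E : Type*} [Ring E] [Algebra S E]
    (g : A →+* E) (hg : ∀ r a, g (r • a) = φ r • g a) :
    ∃ Ψ : A' →ₐ[S] E, ∀ a, Ψ (j a) = g a := by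
  let f : A' →ₗ[S] E := β'.constr S fun i => g (β i)
  have hf : ∀ a, f (j a) = g a := by
    intro a
    rw [h.map_eq_sum, map_sum]
    conv_rhs => rw [← β.sum_repr a, map_sum]
    refine Finset.sum_congr rfl fun i _ => ?_
    rw [_root_.map_smul, hg, β'.constr_basis]
  refine ⟨AlgHom.ofLinearMap f (by rw [← map_one j, hf, map_one]) fun x y => ?_, hf⟩
  have key : (LinearMap.mul S A').compr₂ f = (LinearMap.mul S E).compl₁₂ f f := by
    refine β'.ext fun i => β'.ext fun k => ?_
    simp only [LinearMap.compr₂_apply, LinearMap.compl₁₂_apply, LinearMap.mul_apply', h.map_basis]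
    rw [← map_mul, hf, hf, hf, map_mul]
  exact LinearMap.congr_fun (LinearMap.congr_fun key x) y

end IsScalarExtension

/-- The Gram matrix of the trace form. -/
def traceGram (β : Module.Basis ι R A) : Matrix ι ι R :=
  Matrix.of fun i k => regTrace R A (β i * β k)

-- The Gram matrix is compatible with extension of scalars, so non-degeneracy is the non-vanishing
-- of one discriminant in `R`. It can therefore be checked at the group algebra and carried to the
-- generic field.
open Classical in
theorem isNondegenerateTrace_iff {F : Type*} [Field F] [Algebra F A'] {φ : R →+* F}
    {β' : Module.Basis ι F A'} (h : IsScalarExtension φ j β β') :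
    IsNondegenerateTrace (regTrace F A') ↔ φ (traceGram β).det ≠ 0 := by
  have hgram : ∀ i k, regTrace F A' (β' i * β' k) = φ.mapMatrix (traceGram β) i k := by
    intro i k
    rw [h.map_basis, h.map_basis, ← map_mul, h.regTrace_map]
    rfl
  have hv : ∀ (v : ι → F) k, regTrace F A' ((∑ i, v i • β' i) * β' k)
      = Matrix.vecMul v (φ.mapMatrix (traceGram β)) k := by
    intro v k
    rw [Finset.sum_mul, map_sum]
    simp only [smul_mul_assoc, map_smul, hgram, smul_eq_mul]
    rfl
  rw [RingHom.map_det]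
  constructor
  · intro hτ hdet
    obtain ⟨v, hv0, hv1⟩ := Matrix.exists_vecMul_eq_zero_iff.2 hdet
    refine hv0 (funext fun i => ?_)
    have h1 : ∑ i, v i • β' i = 0 := hτ.eq_zero _ fun b => by
      have h2 : regTrace F A' ∘ₗ LinearMap.mulLeft F (∑ i, v i • β' i) = 0 :=
        β'.ext fun k => by
          rw [LinearMap.comp_apply, LinearMap.mulLeft_apply, hv, hv1]
          rfl
      exact LinearMap.congr_fun h2 b
    exact Fintype.linearIndependent_iff.1 β'.linearIndependent v h1 i
  · refine fun hdet => ⟨regTrace_mul_comm, fun a ha => ?_⟩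
    have h1 : (β'.repr a : ι → F) = 0 := Matrix.eq_zero_of_vecMul_eq_zero hdet (funext fun k => by
      rw [← hv, β'.sum_repr, ha]
      rfl)
    rw [← β'.sum_repr a]
    simp [h1]

/-- The element with coordinates `ψ (z i)`. -/
def ofCoords {P : Type*} [CommRing P] (ψ : P →+* S) (β' : Module.Basis ι S A') (z : ι → P) : A' :=
  ∑ i, ψ (z i) • β' i

open Classical in
theorem regTrace_ofCoords_mul {P : Type*} [CommRing P] {φ : R →+* P} {ψ : P →+* S}
    (h : IsScalarExtension (ψ.comp φ) j β β') (z : ι → P) (k : ι) :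
    regTrace S A' (ofCoords ψ β' z * β' k)
      = ψ (Matrix.vecMul z (φ.mapMatrix (traceGram β)) k) := by
  rw [ofCoords, Finset.sum_mul, map_sum, Matrix.vecMul, dotProduct, map_sum]
  refine Finset.sum_congr rfl fun i _ => ?_
  rw [smul_mul_assoc, map_smul, h.map_basis, h.map_basis, ← map_mul j, h.regTrace_map, smul_eq_mul,
    map_mul ψ]
  rfl

theorem repr_ofCoords_mul {P : Type*} [CommRing P] {φ : R →+* P} {ψ : P →+* S}
    (h : IsScalarExtension (ψ.comp φ) j β β') (z z' : ι → P) (l : ι) :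
    β'.repr (ofCoords ψ β' z * ofCoords ψ β' z') l
      = ψ (∑ i, ∑ k, z i * z' k * φ (β.repr (β i * β k) l)) := by
  simp only [ofCoords, Finset.sum_mul_sum, map_sum, Finsupp.coe_finsetSum, Finset.sum_apply]
  refine Finset.sum_congr rfl fun i _ => Finset.sum_congr rfl fun k _ => ?_
  rw [smul_mul_smul_comm, _root_.map_smul, Finsupp.smul_apply, h.map_basis, h.map_basis,
    ← map_mul j, h.repr_map, smul_eq_mul, map_mul ψ, map_mul ψ]
  rfl

open Classical in
/-- Over a base whose trace form has good reduction, an irreducible character over the generic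
field is determined by its reduction. -/
theorem irr_eq_of_reduction_eq {P F k A_F A_k : Type*} [CommRing P] [Field F] [CharZero F]
    [Field k] [Ring A_F] [Algebra F A_F] [Ring A_k] [Algebra k A_k]
    {φ : R →+* P} {ψ : P →+* F} {ev : P →+* k} (hψ : Function.Injective ψ)
    {j_F : A →+* A_F} {j_k : A →+* A_k} {β_F : Module.Basis ι F A_F} {β_k : Module.Basis ι k A_k}
    (h_F : IsScalarExtension (ψ.comp φ) j_F β β_F)
    (h_k : IsScalarExtension (ev.comp φ) j_k β β_k)
    (hD : ev (φ (traceGram β).det) ≠ 0) (χ χ' : Irr F A_F)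
    (hχ : ∀ a, ∃ p p', ψ p = χ.1 (j_F a) ∧ ψ p' = χ'.1 (j_F a) ∧ ev p = ev p')
    (hone : ∃ p, ψ p = χ.1 1 ∧ ev p ≠ 0) : χ = χ' := by
  by_contra hne
  have hτ : IsNondegenerateTrace (regTrace F A_F) := (isNondegenerateTrace_iff h_F).2 fun h0 => by
    have h1 : φ (traceGram β).det = 0 := hψ (h0.trans (map_zero ψ).symm)
    rw [h1, map_zero] at hD
    exact hD rfl
  choose X X' hX hX' hXX' using fun i => hχ (β i)
  set D : P := φ (traceGram β).det with hDdef
  set G : Matrix ι ι P := φ.mapMatrix (traceGram β) with hG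
  have hDG : D = G.det := RingHom.map_det φ _
  -- The adjugate replaces the inverse Gram matrix, so that `z` and `z'` have coordinates in `P` and
  -- can be reduced; the price is that they represent `D χ` and `D χ'`.
  have hadj : ∀ Y : ι → P, Matrix.vecMul (Matrix.vecMul Y G.adjugate) G = D • Y := by
    intro Y
    rw [Matrix.vecMul_vecMul, Matrix.adjugate_mul, Matrix.vecMul_smul, Matrix.vecMul_one, hDG]
  set z := Matrix.vecMul X G.adjugate
  set z' := Matrix.vecMul X' G.adjugate
  have key : ∀ (θ : Irr F A_F) (Y : ι → P), (∀ i, ψ (Y i) = θ.1 (j_F (β i))) → ∀ a,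
      regTrace F A_F (ofCoords ψ β_F (Matrix.vecMul Y G.adjugate) * a) = ψ D * θ.1 a := by
    intro θ Y hY a
    have h1 : regTrace F A_F ∘ₗ
        LinearMap.mulLeft F (ofCoords ψ β_F (Matrix.vecMul Y G.adjugate)) = ψ D • θ.1 :=
      β_F.ext fun i => by
        rw [LinearMap.comp_apply, LinearMap.mulLeft_apply, regTrace_ofCoords_mul h_F, ← hG, hadj,
          Pi.smul_apply, smul_eq_mul, map_mul, hY, LinearMap.smul_apply, smul_eq_mul,
          h_F.map_basis]
    exact LinearMap.congr_fun h1 a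
  have hzz : ofCoords ψ β_F z * ofCoords ψ β_F z' = 0 :=
    hτ.mul_eq_zero hne (key χ X hX) (key χ' X' hX')
  have hevz : ∀ i, ev (z i) = ev (z' i) := by
    intro i
    simp only [z, z', Matrix.vecMul, dotProduct, map_sum, map_mul, hXX']
  have hcoords : ofCoords ev β_k z = ofCoords ev β_k z' := by
    simp only [ofCoords, hevz]
  -- Orthogonality over `F` is a set of identities in `P`, as `ψ` is injective, so it survives
  -- reduction, where `z` and `z'` coincide.
  have hsq : ofCoords ev β_k z * ofCoords ev β_k z = 0 := by
    conv_lhs => rw [hcoords, ← hcoords]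
    nth_rewrite 2 [hcoords]
    refine β_k.ext_elem fun l => ?_
    have h1 := repr_ofCoords_mul h_F z z' l
    rw [hzz, map_zero, Finsupp.zero_apply] at h1
    rw [repr_ofCoords_mul h_k, hψ (h1.symm.trans (map_zero ψ).symm), map_zero, map_zero,
      Finsupp.zero_apply]
  -- The trace of the reduction of `z` is also `ev D` times the reduction of `χ(1)`, which is
  -- nonzero.
  have htr := regTrace_eq_zero_of_mul_self (F := k) hsq
  obtain ⟨p, hp, hp0⟩ := hone
  have hp' : p = ∑ i, φ (β.repr 1 i) * X i := hψ (by
    rw [hp, ← map_one j_F, h_F.map_eq_sum, map_sum, map_sum]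
    refine Finset.sum_congr rfl fun i _ => ?_
    rw [map_smul, map_mul, hX, smul_eq_mul, h_F.map_basis]
    rfl)
  rw [← mul_one (ofCoords ev β_k z), ← map_one j_k, h_k.map_eq_sum, Finset.mul_sum, map_sum] at htr
  have h2 : ∀ i, regTrace k A_k
      (ofCoords ev β_k z * (ev.comp φ) (β.repr 1 i) • β_k i) = ev D * ev (φ (β.repr 1 i) * X i) := by
    intro i
    rw [mul_smul_comm, map_smul, regTrace_ofCoords_mul h_k, ← hG, hadj, Pi.smul_apply, smul_eq_mul,
      smul_eq_mul, map_mul, map_mul, RingHom.comp_apply]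
    ring
  simp only [h2, ← Finset.mul_sum, ← map_sum, ← hp'] at htr
  exact mul_ne_zero hD hp0 htr

end Extension

/-! ### The group algebra -/

section GroupAlgebra

/-- If the elements `f b` span `A`, and `τ` is a non-degenerate form with `τ (f b) = δ_{w(b),1}`,
then `A` is the group algebra of the image of `w`, and its trace form is non-degenerate. -/
theorem isNondegenerateTrace_of_group {k A B G : Type*} [Field k] [CharZero k] [Ring A]
    [Algebra k A] [Group B] [Group G] [Finite G] (w : B →* G) (f : B →* A)
    (hspan : Submodule.span k (Set.range f) = ⊤) {τ : A →ₗ[k] k} (hτ : IsNondegenerateTrace τ)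
    (h1 : ∀ b, w b = 1 → τ (f b) = 1) (h0 : ∀ b, w b ≠ 1 → τ (f b) = 0) :
    IsNondegenerateTrace (regTrace k A) := by
  classical
  have hzero : ∀ a, (∀ b, τ (a * f b) = 0) → a = 0 := by
    refine fun a ha => hτ.eq_zero a fun x => ?_
    have hx : x ∈ Submodule.span k (Set.range f) := by rw [hspan]; trivial
    induction hx using Submodule.span_induction with
    | mem x hx => obtain ⟨b, rfl⟩ := hx; exact ha b
    | zero => rw [mul_zero, map_zero]
    | add x y _ _ hx hy => rw [mul_add, map_add, hx, hy, add_zero]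
    | smul c x _ hx => rw [mul_smul_comm, map_smul, hx, smul_zero]
  have hτf : ∀ b, τ (f b) = if w b = 1 then 1 else 0 := by
    intro b
    split_ifs with h
    exacts [h1 b h, h0 b h]
  have hf : ∀ b b', w b = w b' → f b = f b' := by
    refine fun b b' hbb' => sub_eq_zero.1 (hzero _ fun c => ?_)
    rw [sub_mul, map_sub, ← map_mul, ← map_mul, hτf, hτf, map_mul, map_mul, hbb', sub_self]
  -- Surjectivity of `w` is not assumed, so its range plays the role of the group.
  let Γ := w.range
  have := Fintype.ofFinite Γ
  choose σ hσ using fun g : Γ => g.2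
  let h : Γ → A := fun g => f (σ g)
  have hh : ∀ b (g : Γ), w b = g → f b = h g := fun b g hb => hf _ _ (hb.trans (hσ g).symm)
  have hli : LinearIndependent k h := by
    rw [Fintype.linearIndependent_iff]
    intro c hc g
    have h2 := congrArg (fun x => τ (x * f (σ g)⁻¹)) hc
    simp only [Finset.sum_mul, map_sum, zero_mul, map_zero, smul_mul_assoc, map_smul, h, ← map_mul,
      hτf] at h2
    simpa [mul_inv_eq_one, hσ, SetLike.coe_eq_coe] using h2
  have hsp : ⊤ ≤ Submodule.span k (Set.range h) := by
    rw [← hspan, Submodule.span_le]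
    rintro _ ⟨b, rfl⟩
    rw [hh b ⟨w b, b, rfl⟩ rfl]
    exact Submodule.subset_span ⟨_, rfl⟩
  let β := Module.Basis.mk hli hsp
  have hβ : ∀ g, β g = h g := fun g => Module.Basis.mk_apply hli hsp g
  -- Left multiplication by `f b` permutes the basis, with fixed points only when `w b = 1`.
  have htr : regTrace k A = (Fintype.card Γ : k) • τ := by
    refine LinearMap.ext_on hspan ?_
    rintro _ ⟨b, rfl⟩
    have hmul : ∀ g : Γ, f b * β g = β (⟨w b, b, rfl⟩ * g) := by
      intro g
      rw [hβ, hβ, ← map_mul]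
      exact hh _ _ (by rw [map_mul, hσ]; rfl)
    rw [regTrace_apply, LinearMap.trace_eq_matrix_trace k β, Matrix.trace, LinearMap.smul_apply,
      hτf]
    have hdiag : ∀ g : Γ, Matrix.diag (LinearMap.toMatrix β β (Algebra.lmul k A (f b))) g
        = if w b = 1 then 1 else 0 := by
      intro g
      rw [Matrix.diag_apply, LinearMap.toMatrix_apply]
      change β.repr (f b * β g) g = _
      rw [hmul, β.repr_self, Finsupp.single_apply]
      refine if_congr ?_ rfl rfl
      rw [mul_eq_right, ← Subtype.coe_inj]
      rfl
    simp only [hdiag, Finset.sum_const, Finset.card_univ, nsmul_eq_mul, smul_eq_mul]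
  refine ⟨regTrace_mul_comm, fun a ha => hτ.eq_zero a fun b => ?_⟩
  have h2 := ha b
  rw [htr, LinearMap.smul_apply, smul_eq_zero] at h2
  exact h2.resolve_left (by exact_mod_cast Fintype.card_ne_zero)

/-- Symmetrizing forms stay non-degenerate under extension of scalars. -/
theorem IsSymmetrizing.isNondegenerateTrace {R k A A' ι : Type*} [CommRing R] [Field k] [Ring A]
    [Ring A'] [Algebra R A] [Algebra k A'] [Fintype ι] {φ : R →+* k} {j : A →+* A'}
    {β : Module.Basis ι R A} {β' : Module.Basis ι k A'} (h : IsScalarExtension φ j β β')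
    {t : A →ₗ[R] R} (ht : IsSymmetrizing t) {τ : A' →ₗ[k] k} (hτ : ∀ a, τ (j a) = φ (t a)) :
    IsNondegenerateTrace τ := by
  classical
  have hcomm : ∀ a b, τ (a * b) = τ (b * a) := by
    have key : (LinearMap.mul k A').compr₂ τ = (LinearMap.mul k A').flip.compr₂ τ := by
      refine β'.ext fun i => β'.ext fun l => ?_
      simp only [LinearMap.compr₂_apply, LinearMap.flip_apply, LinearMap.mul_apply', h.map_basis]
      rw [← map_mul j, ← map_mul j, hτ, hτ, ht.1]
    exact fun a b => LinearMap.congr_fun (LinearMap.congr_fun key a) b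
  refine ⟨hcomm, fun a ha => β'.ext_elem fun i => ?_⟩
  -- The image of the element dual to the `i`-th basis vector stays dual to it, and so reads off the
  -- `i`-th coordinate of `a`.
  obtain ⟨d, hd⟩ := ht.2.2 (β.coord i)
  have h1 : τ ∘ₗ LinearMap.mulLeft k (j d) = β'.coord i := β'.ext fun l => by
    have h2 := LinearMap.congr_fun hd (β l)
    simp only [LinearMap.comp_apply, LinearMap.mulLeft_apply, Module.Basis.coord_apply,
      β.repr_self] at h2
    rw [LinearMap.comp_apply, LinearMap.mulLeft_apply, h.map_basis, ← map_mul j, hτ, h2,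
      ← h.map_basis, Module.Basis.coord_apply, β'.repr_self, Finsupp.single_apply,
      Finsupp.single_apply]
    split_ifs <;> simp
  have h2 := LinearMap.congr_fun h1 a
  rw [LinearMap.comp_apply, LinearMap.mulLeft_apply, hcomm, ha] at h2
  rw [map_zero, Finsupp.zero_apply]
  exact h2.symm

end GroupAlgebra

/-! ### Lengths of braids -/

section Length

section Finiteness

variable {K : Type*} [Field K] {V : Type*} [AddCommGroup V] [Module K V]
  {W : Subgroup (V ≃ₗ[K] V)} [Finite W]

theorem finite_orbits : Finite (Orbits W) :=
  have : Finite (hyperplanes W) := finite_hyperplanes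
  Quotient.finite _

variable [Algebra K ℂ] {x₀ : Regular W}

theorem finite_heckeAlgebra [Module.Free (ParamRing W) (HeckeAlgebra x₀)]
    (hrank : Module.finrank (ParamRing W) (HeckeAlgebra x₀) = Nat.card W) :
    Module.Finite (ParamRing W) (HeckeAlgebra x₀) :=
  Module.finite_of_finrank_pos (by rw [hrank]; exact Nat.card_pos)

end Finiteness

variable {K : Type*} [Field K] [NumberField K] [Algebra K ℂ]
  {V : Type*} [AddCommGroup V] [Module K V] [FiniteDimensional K V]
  {W : Subgroup (V ≃ₗ[K] V)} [Finite W] {x₀ : Regular W}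

open Classical in
/-- The length function of `B` attached to an orbit of hyperplanes; it gives the degree of the
values of the canonical form. -/
theorem exists_length [Module.Free (ParamRing W) (HeckeAlgebra x₀)]
    (hrank : Module.finrank (ParamRing W) (HeckeAlgebra x₀) = Nat.card W)
    (hW : IsGeneratedByReflections W)
    {t : HeckeAlgebra x₀ →ₗ[ParamRing W] ParamRing W}
    (ht : IsCanonicalForm x₀ t) (huniq : ∀ t', IsCanonicalForm x₀ t' → t' = t) (C : Orbits W) :
    ∃ ℓ : BraidGroup x₀ →* Multiplicative ℤ,
      (∀ C' b, IsMonodromyGenerator x₀ C' b →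
        (ℓ b).toAdd = if C' = C then 1 else 0) ∧
      ∀ b a, (t (braidImage x₀ b)).coeff a ≠ 0 → orbitDegree C a = (ℓ b).toAdd := by
  have hfin := finite_heckeAlgebra hrank
  obtain ⟨L, hL⟩ := exists_degree (x₀ := x₀) C
  have hN : (Module.finrank (ParamRing W) (HeckeAlgebra x₀) : ℤ) ≠ 0 := by
    rw [hrank]
    exact_mod_cast Nat.card_pos.ne'
  set N : ℤ := (Module.finrank (ParamRing W) (HeckeAlgebra x₀) : ℤ)
  -- The length is the quotient `L/N`, additive because `N ≠ 0`.
  choose ℓ hℓ using dvd_degree hW ht huniq C N L hL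
  refine ⟨
    { toFun := fun b => Multiplicative.ofAdd (ℓ b)
      map_one' := by
        have h1 := hℓ 1
        rw [map_one, toAdd_one, eq_comm, mul_eq_zero] at h1
        rw [h1.resolve_left hN, ofAdd_zero]
      map_mul' := fun b b' => by
        have h1 := hℓ (b * b')
        rw [map_mul, toAdd_mul, hℓ b, hℓ b', ← mul_add] at h1
        rw [← ofAdd_add, mul_left_cancel₀ hN h1] }, fun C' b hb => ?_, fun b a ha => ?_⟩
  · refine mul_left_cancel₀ hN ((hℓ b).symm.trans ?_)
    rw [hL C' b hb, toAdd_ofAdd]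
    split_ifs <;> simp
  · exact mul_left_cancel₀ hN ((canonicalForm_homogeneous ht huniq C N L hL b ha).trans (hℓ b))

end Length

/-! ### Specializations -/

section Specialization

variable {K : Type*} [Field K] {V : Type*} [AddCommGroup V] [Module K V]
  {W : Subgroup (V ≃ₗ[K] V)}

/-- Characters of the group of monomials are determined by their values on the indeterminates. -/
theorem monomial_hom_ext {S : Type*} [CommRing S] {f g : Multiplicative (ParamIndex W →₀ ℤ) →* S}
    (h : ∀ i, f (Multiplicative.ofAdd (Finsupp.single i 1))
      = g (Multiplicative.ofAdd (Finsupp.single i 1))) : f = g := by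
  have key : AddMonoidHom.toMultiplicativeLeft.symm f.toHomUnits
      = AddMonoidHom.toMultiplicativeLeft.symm g.toHomUnits := by
    refine Finsupp.addHom_ext' fun i => AddMonoidHom.ext_int ?_
    exact Units.ext (h i)
  refine MonoidHom.ext fun a => ?_
  exact congrArg Units.val (DFunLike.congr_fun key a.toAdd)

theorem paramRing_hom_ext_param {S : Type*} [CommRing S] {f g : ParamRing W →+* S}
    (h : ∀ i, f (param i) = g (param i)) : f = g := by
  refine paramRing_hom_ext fun a => ?_
  have h1 : (f : ParamRing W →* S).comp (AddMonoidAlgebra.of ℤ _)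
      = (g : ParamRing W →* S).comp (AddMonoidAlgebra.of ℤ _) := monomial_hom_ext h
  exact DFunLike.congr_fun h1 (Multiplicative.ofAdd a)

/-- Rescaling the indeterminates attached to each orbit `C` by `y_C` multiplies the value of a
homogeneous element by the corresponding product of powers of the `y_C`. -/
theorem map_eq_prod_mul_of_homogeneous [Fintype (Orbits W)] {S : Type*} [CommRing S]
    (φ φ' : ParamRing W →+* S) (y : Orbits W → Sˣ)
    (h : ∀ i, φ' (param i) = y i.1 * φ (param i)) (d : Orbits W → ℤ) (p : ParamRing W)
    (hp : ∀ a, p.coeff a ≠ 0 → ∀ C, orbitDegree C a = d C) :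
    φ' p = ((∏ C, y C ^ d C : Sˣ) : S) * φ p := by
  classical
  let E : Multiplicative (ParamIndex W →₀ ℤ) →* S :=
    { toFun := fun a => ((∏ C, y C ^ orbitDegree C a.toAdd : Sˣ) : S)
      map_one' := by simp
      map_mul' := fun a b => by
        rw [← Units.val_mul, ← Finset.prod_mul_distrib]
        simp only [toAdd_mul, map_add, zpow_add] }
  have key : (φ' : ParamRing W →* S).comp (AddMonoidAlgebra.of ℤ _)
      = E * (φ : ParamRing W →* S).comp (AddMonoidAlgebra.of ℤ _) := by
    refine monomial_hom_ext fun i => (h i).trans ?_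
    rw [MonoidHom.mul_apply]
    congr 2
    change y i.1 = ∏ C, y C ^ orbitDegree C (Finsupp.single i 1)
    rw [Finset.prod_eq_single i.1]
    · simp [orbitDegree_single]
    · intro C _ hC
      simp [orbitDegree_single, hC.symm]
    · simp
  have hmon : ∀ a, φ' (AddMonoidAlgebra.single a 1)
      = ((∏ C, y C ^ orbitDegree C a : Sˣ) : S) * φ (AddMonoidAlgebra.single a 1) := fun a =>
    DFunLike.congr_fun key (Multiplicative.ofAdd a)
  have hsum : p = ∑ a ∈ p.coeff.support, p.coeff a • AddMonoidAlgebra.single a (1 : ℤ) := by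
    conv_lhs => rw [← AddMonoidAlgebra.sum_coeff_single p]
    refine Finset.sum_congr rfl fun a _ => ?_
    rw [AddMonoidAlgebra.smul_single, smul_eq_mul, mul_one]
  rw [hsum, map_sum, map_sum, Finset.mul_sum]
  refine Finset.sum_congr rfl fun a ha => ?_
  have hd := hp a (Finsupp.mem_support_iff.1 ha)
  rw [map_zsmul, map_zsmul, hmon, mul_smul_comm]
  simp only [hd]

end Specialization

/-! ### Cyclotomic Hecke algebras -/

section CyclotomicAlgebra

theorem eval₂_yVar_injective {K : Type*} [Field K] :
    Function.Injective (LaurentPolynomial.eval₂ (intToRatFunc K) (yVar K)) := by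
  refine (injective_iff_map_eq_zero _).2 fun p hp => ?_
  obtain ⟨n, f, hf⟩ := LaurentPolynomial.exists_T_pow p
  have h1 : LaurentPolynomial.eval₂ (intToRatFunc K) (yVar K) (Polynomial.toLaurent f) = 0 := by
    rw [hf, map_mul, hp, zero_mul]
  rw [LaurentPolynomial.eval₂_toLaurent] at h1
  have h2 : algebraMap (Polynomial K) (RatFunc K)
      (f.map (algebraMap (NumberField.RingOfIntegers K) K)) = 0 := by
    rw [← h1]
    refine RingHom.congr_fun (f := (algebraMap (Polynomial K) (RatFunc K)).comp
        (Polynomial.mapRingHom (algebraMap (NumberField.RingOfIntegers K) K)))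
      (g := Polynomial.eval₂RingHom (intToRatFunc K) (yVar K))
      (Polynomial.ringHom_ext (fun r => ?_) ?_) f
    · simp [intToRatFunc]
    · simp [yVar]
  have h3 := (map_eq_zero_iff _ (IsFractionRing.injective (Polynomial K) (RatFunc K))).1 h2
  have h4 : f = 0 := (Polynomial.map_eq_zero_iff
    (FaithfulSMul.algebraMap_injective (NumberField.RingOfIntegers K) K)).1 h3
  rw [h4, map_zero] at hf
  exact (LaurentPolynomial.isUnit_T _).mul_left_eq_zero.1 hf.symm

variable {K : Type*} [Field K] [NumberField K] [Algebra K ℂ]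
  {V : Type*} [AddCommGroup V] [Module K V] {W : Subgroup (V ≃ₗ[K] V)} [Finite W]

theorem extendForm_tmul {R A S : Type*} [CommRing R] [Ring A] [Algebra R A] [CommRing S]
    [Algebra R S] (t : A →ₗ[R] R) (s : S) (a : A) :
    extendForm S t (s ⊗ₜ a) = algebraMap R S (t a) * s := by
  simp [extendForm, Algebra.smul_def]

/-- The specialization `ℤ[𝐮, 𝐮⁻¹] → K(y)` defined by `φ_𝐦`. -/
def cyclotomicHom (m : Weights W) : ParamRing W →+* RatFunc K :=
  (algebraMap (CyclotomicRing m) (RatFunc K)).comp (algebraMap (ParamRing W) (CyclotomicRing m))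

theorem cyclotomicHom_param (m : Weights W) (i : ParamIndex W) :
    cyclotomicHom m (param i)
      = intToRatFunc K ((zeta (K := K) i.1 ^ (i.2 : ℕ) : (NumberField.RingOfIntegers K)ˣ) :
          NumberField.RingOfIntegers K) * ((yVar K ^ rootsCard K) ^ m i.1 i.2 : (RatFunc K)ˣ) := by
  change LaurentPolynomial.eval₂ (intToRatFunc K) (yVar K ^ rootsCard K) (specialize _ (param i)) = _
  rw [specialize_param, Units.val_mul, map_mul]
  congr 1
  · exact LaurentPolynomial.eval₂_C ..
  · have h1 : Units.map (LaurentPolynomial.eval₂ (intToRatFunc K) (yVar K ^ rootsCard K)).toMonoidHom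
        (laurentVar (NumberField.RingOfIntegers K)) = yVar K ^ rootsCard K := by
      refine Units.ext ((LaurentPolynomial.eval₂_T _ _ 1).trans ?_)
      rw [zpow_one]
    rw [← h1, ← map_zpow, h1]
    rfl

/-- The specialization `u_{C,j} ↦ ζ^j y^(|μ(K)| m_{C,j})` with values in `ℤ_K[y, y⁻¹]`. -/
def laurentHom (m : Weights W) : ParamRing W →+* (NumberField.RingOfIntegers K)[T;T⁻¹] :=
  specialize fun i =>
    Units.map (LaurentPolynomial.C : NumberField.RingOfIntegers K →+* _).toMonoidHom
        (zeta i.1 ^ (i.2 : ℕ))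
      * laurentVar (NumberField.RingOfIntegers K) ^ ((rootsCard K : ℤ) * m i.1 i.2)

theorem eval₂_laurentHom_param {S : Type*} [CommRing S] (f : NumberField.RingOfIntegers K →+* S)
    (y : Sˣ) (m : Weights W) (i : ParamIndex W) :
    LaurentPolynomial.eval₂ f y (laurentHom m (param i))
      = f ((zeta (K := K) i.1 ^ (i.2 : ℕ) : (NumberField.RingOfIntegers K)ˣ) :
          NumberField.RingOfIntegers K) * (y ^ ((rootsCard K : ℤ) * m i.1 i.2) : Sˣ) := by
  rw [laurentHom, specialize_param, Units.val_mul, map_mul]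
  congr 1
  · exact LaurentPolynomial.eval₂_C ..
  · have h1 : Units.map (LaurentPolynomial.eval₂ f y).toMonoidHom
        (laurentVar (NumberField.RingOfIntegers K)) = y := by
      refine Units.ext ((LaurentPolynomial.eval₂_T _ _ 1).trans ?_)
      rw [zpow_one]
    conv_rhs => rw [← h1, ← map_zpow]
    rfl

/-- With `eval₂_one_comp_laurentHom`, this shows that the generic field and the group algebra are
reached through the same ring `ℤ_K[y, y⁻¹]`, by inclusion and by `y ↦ 1`. -/
theorem eval₂_comp_laurentHom (m : Weights W) :
    (LaurentPolynomial.eval₂ (intToRatFunc K) (yVar K)).comp (laurentHom m) = cyclotomicHom m :=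
  paramRing_hom_ext_param fun i => by
    rw [RingHom.comp_apply, eval₂_laurentHom_param, cyclotomicHom_param, zpow_mul, zpow_natCast]

variable (W) in
/-- The specialization `u_{C,j} ↦ ζ^j`, with values in `K`. -/
def groupHom : ParamRing W →+* K :=
  (algebraMap (NumberField.RingOfIntegers K) K).comp
    (specialize fun i : ParamIndex W => zeta (K := K) i.1 ^ (i.2 : ℕ))

theorem eval₂_one_comp_laurentHom (m : Weights W) :
    (LaurentPolynomial.eval₂ (algebraMap (NumberField.RingOfIntegers K) K) 1).comp (laurentHom m)
      = groupHom W :=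
  paramRing_hom_ext_param fun i => by
    rw [RingHom.comp_apply, eval₂_laurentHom_param, groupHom, RingHom.comp_apply, specialize_param,
      one_zpow, Units.val_one, mul_one]

variable (x₀ : Regular W) (m : Weights W)

/-- The map `ℋ(W) → K(y)ℋ_𝐦`. -/
def toCyclotomic : HeckeAlgebra x₀ →+* CyclotomicHeckeField x₀ m :=
  (Algebra.TensorProduct.includeRight :
    CyclotomicHecke x₀ m →ₐ[CyclotomicRing m] CyclotomicHeckeField x₀ m).toRingHom.comp
  (Algebra.TensorProduct.includeRight :
    HeckeAlgebra x₀ →ₐ[ParamRing W] CyclotomicHecke x₀ m).toRingHom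

theorem toCyclotomic_apply (h : HeckeAlgebra x₀) :
    toCyclotomic x₀ m h = 1 ⊗ₜ[CyclotomicRing m] (1 ⊗ₜ[ParamRing W] h) := rfl

theorem isScalarExtension_cyclotomic {ι : Type*}
    (β : Module.Basis ι (ParamRing W) (HeckeAlgebra x₀)) :
    IsScalarExtension (cyclotomicHom m) (toCyclotomic x₀ m) β
      ((β.baseChange (CyclotomicRing m)).baseChange (RatFunc K)) :=
  (isScalarExtension_includeRight (RatFunc K) (β.baseChange (CyclotomicRing m))).comp
    (isScalarExtension_includeRight (CyclotomicRing m) β)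

theorem cyclotomicForm_apply (t : HeckeAlgebra x₀ →ₗ[ParamRing W] ParamRing W)
    (h : HeckeAlgebra x₀) :
    cyclotomicForm x₀ m t (toCyclotomic x₀ m h) = cyclotomicHom m (t h) := by
  rw [toCyclotomic_apply, cyclotomicForm, extendForm_tmul, extendForm_tmul, mul_one, mul_one]
  rfl

variable {x₀ m}

open Classical in
/-- The discriminant of `ℋ(W)` does not vanish at the group algebra. -/
theorem groupHom_traceGram_ne_zero {ι : Type*} [Fintype ι]
    (β : Module.Basis ι (ParamRing W) (HeckeAlgebra x₀))
    {t : HeckeAlgebra x₀ →ₗ[ParamRing W] ParamRing W} (ht : IsCanonicalForm x₀ t) :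
    groupHom W (traceGram β).det ≠ 0 := by
  let _ : Algebra (ParamRing W) K := (groupHom W).toAlgebra
  have hext := isScalarExtension_includeRight K β
  have hτ : IsNondegenerateTrace (extendForm K t) :=
    ht.symmetrizing.isNondegenerateTrace hext fun a => by
      change extendForm K t (1 ⊗ₜ a) = _
      rw [extendForm_tmul, mul_one]
  refine (isNondegenerateTrace_iff hext).1 ?_
  let f : BraidGroup x₀ →* K ⊗[ParamRing W] HeckeAlgebra x₀ :=
    { toFun := fun b => 1 ⊗ₜ braidImage x₀ b
      map_one' := by rw [braidImage_one]; rfl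
      map_mul' := fun b b' => by
        rw [braidImage_mul, Algebra.TensorProduct.tmul_mul_tmul, one_mul] }
  have hval : ∀ b, extendForm K t (f b) = if braidToGroup x₀ b = 1 then 1 else 0 := by
    intro b
    change extendForm K t (1 ⊗ₜ braidImage x₀ b) = _
    rw [extendForm_tmul, mul_one]
    change algebraMap (NumberField.RingOfIntegers K) K (specialize _ (t (braidImage x₀ b))) = _
    rw [ht.specializes b, apply_ite (algebraMap (NumberField.RingOfIntegers K) K), map_one,
      map_zero]
  refine isNondegenerateTrace_of_group (braidToGroup x₀) f ?_ hτ
    (fun b hb => by rw [hval, if_pos hb]) (fun b hb => by rw [hval, if_neg hb])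
  rw [eq_top_iff, ← (β.baseChange K).span_eq, Submodule.span_le]
  rintro _ ⟨i, rfl⟩
  rw [Module.Basis.baseChange_apply]
  have key : ∀ h : HeckeAlgebra x₀, (1 : K) ⊗ₜ[ParamRing W] h ∈ Submodule.span K (Set.range f) := by
    intro h
    induction h using hecke_induction with
    | braid b => exact Submodule.subset_span ⟨b, rfl⟩
    | add x y hx hy => rw [TensorProduct.tmul_add]; exact Submodule.add_mem _ hx hy
    | smul r x hx =>
      rw [← TensorProduct.smul_tmul, Algebra.smul_def, mul_one, ← mul_one (algebraMap _ K r),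
        ← smul_eq_mul, ← TensorProduct.smul_tmul']
      exact Submodule.smul_mem _ _ hx
  exact key _

/-- The discriminant is a Laurent polynomial in `y` whose value at 1 is the nonzero discriminant of
the group algebra. -/
theorem isNondegenerateTrace_cyclotomic [Module.Free (ParamRing W) (HeckeAlgebra x₀)]
    [Module.Finite (ParamRing W) (HeckeAlgebra x₀)]
    {t : HeckeAlgebra x₀ →ₗ[ParamRing W] ParamRing W} (ht : IsCanonicalForm x₀ t)
    (m : Weights W) :
    IsNondegenerateTrace (regTrace (RatFunc K) (CyclotomicHeckeField x₀ m)) := by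
  classical
  let β := Module.Free.chooseBasis (ParamRing W) (HeckeAlgebra x₀)
  refine (isNondegenerateTrace_iff (isScalarExtension_cyclotomic x₀ m β)).2 fun h0 => ?_
  have h1 := groupHom_traceGram_ne_zero β ht
  rw [← eval₂_comp_laurentHom, RingHom.comp_apply] at h0
  rw [← eval₂_one_comp_laurentHom m, RingHom.comp_apply,
    eval₂_yVar_injective (h0.trans (map_zero _).symm), map_zero] at h1
  exact h1 rfl

/-- At most one irreducible character of `K(y)ℋ_𝐦` specializes to a given character of `W`. -/
theorem SpecializesTo.unique [Module.Free (ParamRing W) (HeckeAlgebra x₀)]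
    [Module.Finite (ParamRing W) (HeckeAlgebra x₀)]
    {t : HeckeAlgebra x₀ →ₗ[ParamRing W] ParamRing W} (ht : IsCanonicalForm x₀ t)
    {lam : Labels W} {χ χ' : Irr (RatFunc K) (CyclotomicHeckeField x₀ m)}
    (h : SpecializesTo x₀ m χ lam) (h' : SpecializesTo x₀ m χ' lam) : χ = χ' := by
  classical
  let β := Module.Free.chooseBasis (ParamRing W) (HeckeAlgebra x₀)
  let _ : Algebra (ParamRing W) K := (groupHom W).toAlgebra
  have h_F := isScalarExtension_cyclotomic x₀ m β
  have h_k := isScalarExtension_includeRight K β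
  have hg : algebraMap (ParamRing W) K = groupHom W := rfl
  have hD := groupHom_traceGram_ne_zero β ht
  rw [← eval₂_one_comp_laurentHom m] at hg hD
  rw [hg] at h_k
  rw [← eval₂_comp_laurentHom] at h_F
  refine irr_eq_of_reduction_eq eval₂_yVar_injective h_F h_k hD χ χ' (fun a => ?_) ?_
  · induction a using hecke_induction with
    | braid b =>
      obtain ⟨p, hp, hp1⟩ := h b
      obtain ⟨p', hp', hp1'⟩ := h' b
      exact ⟨p, p', hp.symm, hp'.symm, hp1.trans hp1'.symm⟩
    | add x y hx hy =>
      obtain ⟨p, p', h1, h2, h3⟩ := hx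
      obtain ⟨q, q', h4, h5, h6⟩ := hy
      exact ⟨p + q, p' + q', by rw [map_add, map_add, map_add, h1, h4],
        by rw [map_add, map_add, map_add, h2, h5], by rw [map_add, map_add, h3, h6]⟩
    | smul r x hx =>
      obtain ⟨p, p', h1, h2, h3⟩ := hx
      refine ⟨laurentHom m r * p, laurentHom m r * p', ?_, ?_, by rw [map_mul, map_mul, h3]⟩
      · rw [h_F.map_smul, map_smul, map_mul, h1]
        rfl
      · rw [h_F.map_smul, map_smul, map_mul, h2]
        rfl
  · obtain ⟨p, hp, hp1⟩ := h 1
    refine ⟨p, ?_, ?_⟩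
    · rw [← hp, braidImage_one]
      rfl
    · rw [hp1, map_one, map_one]
      exact lam.2.apply_one_ne_zero

end CyclotomicAlgebra

/-! ### Invariance of the Schur elements -/

section Invariance

variable {K : Type*} [Field K] [NumberField K] [Algebra K ℂ]
  {V : Type*} [AddCommGroup V] [Module K V] {W : Subgroup (V ≃ₗ[K] V)} [Finite W]
  {x₀ : Regular W}

theorem exists_cyclotomicHom_twist [Module.Free (ParamRing W) (HeckeAlgebra x₀)]
    [Module.Finite (ParamRing W) (HeckeAlgebra x₀)] {m m' : Weights W}
    (c : BraidGroup x₀ →* RatFunc K)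
    (hc : ∀ C b, IsMonodromyGenerator x₀ C b → ∀ j,
      cyclotomicHom (K := K) m' (param ⟨C, j⟩) = c b * cyclotomicHom m (param ⟨C, j⟩)) :
    ∃ Ψ : CyclotomicHeckeField x₀ m' →ₐ[RatFunc K] CyclotomicHeckeField x₀ m,
      ∀ b, Ψ (toCyclotomic x₀ m' (braidImage x₀ b))
        = c b • toCyclotomic x₀ m (braidImage x₀ b) := by
  let β := Module.Free.chooseBasis (ParamRing W) (HeckeAlgebra x₀)
  obtain ⟨g, hg, hgb⟩ := exists_heckeHom_twist (cyclotomicHom m) (cyclotomicHom m')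
    (toCyclotomic x₀ m) (isScalarExtension_cyclotomic x₀ m β).map_smul c hc
  obtain ⟨Ψ, hΨ⟩ := (isScalarExtension_cyclotomic x₀ m' β).exists_lift g hg
  exact ⟨Ψ, fun b => by rw [hΨ, hgb]⟩

theorem cyclotomic_linearMap_ext [Module.Free (ParamRing W) (HeckeAlgebra x₀)] {m : Weights W}
    {M : Type*} [AddCommGroup M] [Module (RatFunc K) M]
    {f g : CyclotomicHeckeField x₀ m →ₗ[RatFunc K] M}
    (h : ∀ b, f (toCyclotomic x₀ m (braidImage x₀ b)) = g (toCyclotomic x₀ m (braidImage x₀ b))) :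
    f = g := by
  let β := Module.Free.chooseBasis (ParamRing W) (HeckeAlgebra x₀)
  have hext := isScalarExtension_cyclotomic x₀ m β
  refine hext.linearMap_ext fun a => ?_
  induction a using hecke_induction with
  | braid b => exact h b
  | add x y hx hy => rw [map_add, map_add, map_add, hx, hy]
  | smul r x hx => rw [hext.map_smul, map_smul, map_smul, hx]

/-- The inverse is the twist by `c⁻¹`; since braids span, the composites need only be checked on
them. -/
theorem exists_cyclotomicEquiv [Module.Free (ParamRing W) (HeckeAlgebra x₀)]
    [Module.Finite (ParamRing W) (HeckeAlgebra x₀)] {m m' : Weights W}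
    (c : BraidGroup x₀ →* (RatFunc K)ˣ)
    (hc : ∀ C b, IsMonodromyGenerator x₀ C b → ∀ j,
      cyclotomicHom (K := K) m' (param ⟨C, j⟩) = c b * cyclotomicHom m (param ⟨C, j⟩)) :
    ∃ Ψ : CyclotomicHeckeField x₀ m' ≃ₐ[RatFunc K] CyclotomicHeckeField x₀ m,
      ∀ b, Ψ (toCyclotomic x₀ m' (braidImage x₀ b))
        = (c b : RatFunc K) • toCyclotomic x₀ m (braidImage x₀ b) := by
  obtain ⟨Ψ, hΨ⟩ := exists_cyclotomicHom_twist ((Units.coeHom (RatFunc K)).comp c) hc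
  obtain ⟨Ψ', hΨ'⟩ := exists_cyclotomicHom_twist (m := m') (m' := m)
    ((Units.coeHom (RatFunc K)).comp c⁻¹) fun C b hb j => by
      rw [hc C b hb j, ← mul_assoc]
      simp
  refine ⟨AlgEquiv.ofAlgHom Ψ Ψ' ?_ ?_, hΨ⟩
  · refine AlgHom.toLinearMap_injective (cyclotomic_linearMap_ext fun b => ?_)
    change Ψ (Ψ' _) = _
    rw [hΨ', map_smul, hΨ, smul_smul]
    simp
  · refine AlgHom.toLinearMap_injective (cyclotomic_linearMap_ext fun b => ?_)
    change Ψ' (Ψ _) = _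
    rw [hΨ, map_smul, hΨ', smul_smul]
    simp

/-- Values on braids are multiplied by powers of `y`, which keeps them Laurent polynomials and does
not affect their value at `y = 1`. -/
theorem SpecializesTo.comp {m m' : Weights W}
    (Ψ : CyclotomicHeckeField x₀ m' ≃ₐ[RatFunc K] CyclotomicHeckeField x₀ m)
    (k : BraidGroup x₀ → ℤ)
    (hΨ : ∀ b, Ψ (toCyclotomic x₀ m' (braidImage x₀ b))
      = ((yVar K ^ k b : (RatFunc K)ˣ) : RatFunc K) • toCyclotomic x₀ m (braidImage x₀ b))
    {χ : Irr (RatFunc K) (CyclotomicHeckeField x₀ m)} {lam : Labels W}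
    (h : SpecializesTo x₀ m χ lam) :
    SpecializesTo x₀ m' ⟨χ.1 ∘ₗ Ψ.toLinearMap, χ.2.comp Ψ⟩ lam := by
  intro b
  obtain ⟨P, hP, hP1⟩ := h b
  refine ⟨LaurentPolynomial.T (k b) * P, ?_, ?_⟩
  · change χ.1 (Ψ (toCyclotomic x₀ m' (braidImage x₀ b))) = _
    rw [hΨ, map_smul, map_mul, LaurentPolynomial.eval₂_T, ← hP]
    rfl
  · rw [map_mul, LaurentPolynomial.eval₂_T, one_zpow, Units.val_one, one_mul, hP1]

/-- By uniqueness of the character over `lam`, the chosen characters correspond under `Ψ`. If one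
side has no such character then neither does the other, and both values are the default 0. -/
theorem cyclotomicSchurElement_eq_of_equiv [Module.Free (ParamRing W) (HeckeAlgebra x₀)]
    [Module.Finite (ParamRing W) (HeckeAlgebra x₀)]
    {t : HeckeAlgebra x₀ →ₗ[ParamRing W] ParamRing W} (ht : IsCanonicalForm x₀ t)
    {m m' : Weights W}
    (Ψ : CyclotomicHeckeField x₀ m' ≃ₐ[RatFunc K] CyclotomicHeckeField x₀ m)
    (k : BraidGroup x₀ → ℤ)
    (hΨ : ∀ b, Ψ (toCyclotomic x₀ m' (braidImage x₀ b))
      = ((yVar K ^ k b : (RatFunc K)ˣ) : RatFunc K) • toCyclotomic x₀ m (braidImage x₀ b))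
    (hform : cyclotomicForm x₀ m' t = cyclotomicForm x₀ m t ∘ₗ Ψ.toLinearMap) (lam : Labels W) :
    cyclotomicSchurElement x₀ m t lam = cyclotomicSchurElement x₀ m' t lam := by
  by_cases h : ∃ χ, SpecializesTo x₀ m χ lam
  · have hχ' := h.choose_spec.comp Ψ k hΨ
    have h' : ∃ χ, SpecializesTo x₀ m' χ lam := ⟨_, hχ'⟩
    rw [cyclotomicSchurElement, cyclotomicSchurElement, dif_pos h, dif_pos h',
      h'.choose_spec.unique ht hχ', hform]
    exact (schurElement_comp (isNondegenerateTrace_cyclotomic ht m)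
      (isNondegenerateTrace_cyclotomic ht m') Ψ _ _).symm
  · have h' : ¬ ∃ χ, SpecializesTo x₀ m' χ lam := by
      rintro ⟨χ, hχ⟩
      refine h ⟨_, hχ.comp Ψ.symm (fun b => -k b) fun b => ?_⟩
      rw [AlgEquiv.symm_apply_eq, map_smul, hΨ, smul_smul, ← Units.val_mul, ← zpow_add,
        neg_add_cancel, zpow_zero, Units.val_one, one_smul]
    rw [cyclotomicSchurElement, cyclotomicSchurElement, dif_neg h, dif_neg h']

theorem cyclotomicSchurElement_add [FiniteDimensional K V]
    (hW : IsGeneratedByReflections W)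
    [Module.Free (ParamRing W) (HeckeAlgebra x₀)]
    (hrank : Module.finrank (ParamRing W) (HeckeAlgebra x₀) = Nat.card W)
    {t : HeckeAlgebra x₀ →ₗ[ParamRing W] ParamRing W} (ht : IsCanonicalForm x₀ t)
    (huniq : ∀ t', IsCanonicalForm x₀ t' → t' = t) (m n : Weights W)
    (hn : ∀ (C : Orbits W) (i j : Fin (ramification C)), n C i = n C j) (lam : Labels W) :
    cyclotomicSchurElement x₀ m t lam = cyclotomicSchurElement x₀ (m + n) t lam := by
  classical
  have hfin := finite_heckeAlgebra hrank
  have : Finite (Orbits W) := finite_orbits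
  have := Fintype.ofFinite (Orbits W)
  choose ℓ hℓ hdeg using exists_length hrank hW ht huniq
  -- The common value of `n` on the orbit, read off at `j = 0`.
  let ν : Orbits W → ℤ := fun C => n C ⟨0, zero_lt_one.trans (one_lt_ramification C)⟩
  let y : Orbits W → (RatFunc K)ˣ := fun C => (yVar K ^ rootsCard K) ^ ν C
  have hparam : ∀ i : ParamIndex W,
      cyclotomicHom (m + n) (param i) = y i.1 * cyclotomicHom (K := K) m (param i) := by
    intro i
    rw [cyclotomicHom_param, cyclotomicHom_param, Pi.add_apply, Pi.add_apply, zpow_add,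
      Units.val_mul, hn i.1 i.2 ⟨0, zero_lt_one.trans (one_lt_ramification i.1)⟩]
    ring
  let c : BraidGroup x₀ →* (RatFunc K)ˣ :=
    { toFun := fun b => ∏ C, y C ^ (ℓ C b).toAdd
      map_one' := by simp
      map_mul' := fun b b' => by
        rw [← Finset.prod_mul_distrib]
        simp only [map_mul, toAdd_mul, zpow_add] }
  -- The twisting scalar `c b` is a pure power of `y`; this exponent is what the comparison at `y =
  -- 1` requires.
  let k : BraidGroup x₀ → ℤ := fun b => ∑ C, (rootsCard K : ℤ) * ν C * (ℓ C b).toAdd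
  have hck : ∀ b, c b = yVar K ^ k b := by
    intro b
    change ∏ C, y C ^ (ℓ C b).toAdd = yVar K ^ ∑ C, (rootsCard K : ℤ) * ν C * (ℓ C b).toAdd
    refine Eq.trans ?_ (map_prod (zpowersHom (RatFunc K)ˣ (yVar K))
      (fun C => Multiplicative.ofAdd ((rootsCard K : ℤ) * ν C * (ℓ C b).toAdd)) _).symm
    refine Finset.prod_congr rfl fun C _ => ?_
    rw [zpowersHom_apply, toAdd_ofAdd, zpow_mul, zpow_mul, zpow_natCast]
  obtain ⟨Ψ, hΨ⟩ := exists_cyclotomicEquiv (m := m) (m' := m + n) c fun C b hb j => by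
    rw [hparam]
    congr 2
    change y C = ∏ C', y C' ^ (ℓ C' b).toAdd
    rw [Finset.prod_eq_single C]
    · rw [hℓ C C b hb, if_pos rfl, zpow_one]
    · intro C' _ hC'
      rw [hℓ C' C b hb, if_neg hC'.symm, zpow_zero]
    · simp
  refine cyclotomicSchurElement_eq_of_equiv ht Ψ k (fun b => by rw [hΨ, hck]) ?_ lam
  refine cyclotomic_linearMap_ext fun b => ?_
  rw [LinearMap.comp_apply, AlgEquiv.toLinearMap_apply, hΨ, map_smul, cyclotomicForm_apply,
    cyclotomicForm_apply, smul_eq_mul]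
  -- Homogeneity of `t(b)` enters here: rescaling the indeterminates multiplies its value by exactly
  -- `c b`.
  exact map_eq_prod_mul_of_homogeneous _ _ y hparam (fun C => (ℓ C b).toAdd) _
    fun a ha C => hdeg C b a ha

end Invariance

end ReflectionHecke

end

/-! ### Invariance of the Schur elements and of the function `a` -/

open ReflectionHecke in
theorem mainTheorem5 {K : Type*} [Field K] [NumberField K] [IsAbelianGalois ℚ K] [Algebra K ℂ]
    {V : Type*} [AddCommGroup V] [Module K V] [FiniteDimensional K V]
    (W : Subgroup (V ≃ₗ[K] V)) [Finite W]
    (hW : IsGeneratedByReflections W) (hirr : ActsIrreducibly W)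
    (x₀ : Regular W)
    (hfree : Module.Free (ParamRing W) (HeckeAlgebra x₀))
    (hrank : Module.finrank (ParamRing W) (HeckeAlgebra x₀) = Nat.card W)
    (t : HeckeAlgebra x₀ →ₗ[ParamRing W] ParamRing W)
    (ht : IsCanonicalForm x₀ t)
    (huniq : ∀ t' : HeckeAlgebra x₀ →ₗ[ParamRing W] ParamRing W,
      IsCanonicalForm x₀ t' → t' = t)
    (m n : Weights W)
    (hn : ∀ (C : Orbits W) (i j : Fin (ramification C)), n C i = n C j)
    (lam : Labels W) :
    cyclotomicSchurElement x₀ m t lam = cyclotomicSchurElement x₀ (m + n) t lam ∧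
      aFunction x₀ m t lam = aFunction x₀ (m + n) t lam := by
  have h := cyclotomicSchurElement_add hW hrank ht huniq m n hn lam
  exact ⟨h, by rw [aFunction, aFunction, h]⟩
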